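/- Let $Q$ be a finite-dimensional smooth (Hausdorff, second countable) manifold and $\pi:Q\to\mathbb R$ a smooth, locally trivial fibre bundle whose typical fibre is a finite-dimensional smooth manifold, with bundle coordinates $(q^\lambda)=(q^0=t,q^i)$. Write $(t,q^i,\dot t,\dot q^i)$ for the induced coordinates on $TQ$, and identify the first order jet manifold $J^1Q$ of sections of $\pi$ with the submanifold $\{\dot t=1\}\subset TQ$ by the canonical imbedding $\lambda:(t,q^i,q^i_t)\mapsto(t,q^i,\dot t=1,\dot q^i=q^i_t)$; put $\partial_i^t=\partial/\partial q^i_t$. Likewise the second order jet manifold $J^2Q$ is identified with its image in $TTQ$ by $(t,q^i,q^i_t,q^i_{tt})\mapsto(\dot t=1,\ \dot q^i=q^i_t,\ \ddot t=0,\ \ddot q^i=q^i_{tt})$. Let $$\xi=\partial_t+q^i_t\partial_i+\xi^i(t,q^j,q^j_t)\,\partial_i^t$$ be a smooth holonomic connection on $J^1Q\to\mathbb R$. The associated dynamic equation $q^i_{tt}=\xi^i$ is the image $\xi(J^1Q)\subset J^2Q$; a motion of $\xi$ is a smooth section $c$ of $\pi$ over an open interval whose second order jet prolongation lies in this image. A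 dynamic connection is a smooth connection $\gamma=dq^\lambda\otimes(\partial_\lambda+\gamma^i_\lambda\partial_i^t)$ on $J^1Q\to Q$; it generates $\xi$ if $\xi^i=\gamma^i_0+q^j_t\gamma^i_j$. Then the following hold. 1. There is a dynamic connection $\gamma_\xi$ with components $\gamma^i_j=\tfrac12\partial_j^t\xi^i$ and $\gamma^i_0=\xi^i-\tfrac12 q^j_t\,\partial_j^t\xi^i$, and it generates $\xi$. 2. For every dynamic connection $\gamma$ generating $\xi$ (in particular for $\gamma_\xi$) there is a smooth, in general non-linear, connection $\widetilde K=dq^\lambda\otimes(\partial_\lambda+K^i_\lambda\,\partial/\partial\dot q^i)$ on $TQ\to Q$, i.e. one with $K^0_\mu=0$, such that $K^i_\mu\circ\lambda=\gamma^i_\mu$. 3. For every dynamic connection $\gamma$ generating $\xi$ and every connection $\widetilde K$ as in 2, the dynamic equation is equivalent to the geodesic equation $$\ddot t=0,\qquad \dot t=1,\qquad \ddot q^i=K^i_\lambda\dot q^\lambda$$ on $TQ$. That is, the two equations define the same subset of $TTQ$. Consequently a smooth section of $\pi$ over an open interval is a motion of $\xi$ if and only if it is a solution of the geodesic equation. A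 smooth curve $c$ in $Q$ defined on an open interval is a solution of the geodesic equation (i.e. its second tangent prolongation $\ddot c$ lies in it) if and only if, for some constant $a\in\mathbb R$, the shifted curve $s\mapsto c(s-a)$ is a motion of $\xi$. -/

import Mathlib

open Set Topology
open scoped Manifold ContDiff

noncomputable section

namespace TimeBundle

variable {E : Type*} [NormedAddCommGroup E] [NormedSpace ℝ E]
  {Q : Type*} [TopologicalSpace Q] [ChartedSpace E Q]

/-- `π : Q → ℝ` is a smooth (locally trivial) fibre bundle with typical fibre the manifold `M`:
around every instant there is a local trivialization over an open set of instants which is a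
diffeomorphism onto its image. -/
def IsSmoothBundle (F : Type*) [NormedAddCommGroup F] [NormedSpace ℝ F]
    (M : Type*) [TopologicalSpace M] [ChartedSpace F M] (π : Q → ℝ) : Prop :=
  ∀ t : ℝ, ∃ e : Bundle.Trivialization M π, t ∈ e.baseSet ∧
    ContMDiffOn 𝓘(ℝ, E) (𝓘(ℝ, ℝ).prod 𝓘(ℝ, F)) ∞ e e.source ∧
    ContMDiffOn (𝓘(ℝ, ℝ).prod 𝓘(ℝ, F)) 𝓘(ℝ, E) ∞ e.toOpenPartialHomeomorph.symm e.target

/-- The coordinate `ṫ` on `TQ`, i.e. the 1-form `dt` (pulled back to `Q` by `π`) seen as a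
function on the tangent bundle. -/
def tdot (π : Q → ℝ) (v : TangentBundle 𝓘(ℝ, E) Q) : ℝ :=
  (mfderiv 𝓘(ℝ, E) 𝓘(ℝ, ℝ) π v.proj v.2 : ℝ)

/-- The first order jet manifold `J¹Q` of sections of `π : Q → ℝ`, identified with its image
`ṫ = 1` under the canonical imbedding `λ : J¹Q → TQ`, which sends the 1-jet of a section to its
velocity. -/
def J1 (π : Q → ℝ) : Set (TangentBundle 𝓘(ℝ, E) Q) := {v | tdot π v = 1}

variable [IsManifold 𝓘(ℝ, E) ∞ Q]

/-- The linear function `ẗ` on the tangent space of `TQ` at `v`: the differential of `ṫ`. On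
`J¹Q` its kernel is the tangent space of `J¹Q`. -/
def tddot (π : Q → ℝ) (v : TangentBundle 𝓘(ℝ, E) Q)
    (ζ : TangentSpace (𝓘(ℝ, E).tangent) v) : ℝ :=
  (mfderiv 𝓘(ℝ, E).tangent 𝓘(ℝ, ℝ) (tdot π) v ζ : ℝ)

/-- The tangent map `TTQ → TQ` of the projection `TQ → Q`, at `v`. -/
def Tproj (v : TangentBundle 𝓘(ℝ, E) Q) (ζ : TangentSpace (𝓘(ℝ, E).tangent) v) :
    TangentSpace 𝓘(ℝ, E) v.proj :=
  mfderiv 𝓘(ℝ, E).tangent 𝓘(ℝ, E)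
    (Bundle.TotalSpace.proj : TangentBundle 𝓘(ℝ, E) Q → Q) v ζ

/-- The components `q̈^μ` of a tangent vector `ζ` of `TQ` at `v`, in the coordinates
`(q^μ, q̇^μ)` on `TQ` induced by the chart `φ = (q^μ)` of `Q`: the derivative along `ζ` of the
fibre coordinates `q̇^μ`. -/
def qddot (φ : OpenPartialHomeomorph Q E) (v : TangentBundle 𝓘(ℝ, E) Q)
    (ζ : TangentSpace (𝓘(ℝ, E).tangent) v) : E :=
  (mfderiv 𝓘(ℝ, E).tangent 𝓘(ℝ, E)
    (fun p : TangentBundle 𝓘(ℝ, E) Q => (mfderiv 𝓘(ℝ, E) 𝓘(ℝ, E) φ p.proj p.2 : E)) v ζ : E)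

/-- A holonomic connection `ξ = ∂_t + q^i_t ∂_i + ξ^i ∂_i^t` on `J¹Q → ℝ`: a smooth vector field
on `J¹Q` (a section of `TTQ` over `J¹Q`, tangent to `J¹Q`) whose value at `v` projects to `v`
itself. Values of `ξ` off `J¹Q` are irrelevant. -/
structure IsHolonomicConnection (π : Q → ℝ)
    (ξ : ∀ v : TangentBundle 𝓘(ℝ, E) Q, TangentSpace (𝓘(ℝ, E).tangent) v) : Prop where
  smooth : ContMDiffOn 𝓘(ℝ, E).tangent 𝓘(ℝ, E).tangent.tangent ∞
    (fun v => (⟨v, ξ v⟩ :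
      TangentBundle 𝓘(ℝ, E).tangent (TangentBundle 𝓘(ℝ, E) Q))) (J1 π)
  tangent : ∀ v ∈ J1 π, tddot π v (ξ v) = 0
  holonomic : ∀ v ∈ J1 π, Tproj v (ξ v) = v.2

/-- Smoothness on a set `S ⊆ TQ` of a family of linear maps `K v : T_{q} Q → T_v TQ`
(`v` over `q`), read in the tangent bundle charts. -/
def SmoothLiftOn
    (K : ∀ v : TangentBundle 𝓘(ℝ, E) Q,
      TangentSpace 𝓘(ℝ, E) v.proj →L[ℝ] TangentSpace (𝓘(ℝ, E).tangent) v)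
    (S : Set (TangentBundle 𝓘(ℝ, E) Q)) : Prop :=
  ∀ v ∈ S, ContMDiffWithinAt 𝓘(ℝ, E).tangent 𝓘(ℝ, E →L[ℝ] E × E) ∞
    (inTangentCoordinates 𝓘(ℝ, E) 𝓘(ℝ, E).tangent
      (Bundle.TotalSpace.proj : TangentBundle 𝓘(ℝ, E) Q → Q) id K v) S v

/-- A (non-linear) connection `K = dq^λ ⊗ (∂_λ + K^μ_λ ∂/∂q̇^μ)` on `TQ → Q`, given by its
horizontal lifts `w ↦ K v w`, `T_q Q → T_v TQ`. -/
structure IsConnection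
    (K : ∀ v : TangentBundle 𝓘(ℝ, E) Q,
      TangentSpace 𝓘(ℝ, E) v.proj →L[ℝ] TangentSpace (𝓘(ℝ, E).tangent) v) : Prop where
  smooth : SmoothLiftOn K univ
  lift : ∀ v w, Tproj v (K v w) = w

/-- A dynamic connection `γ = dq^λ ⊗ (∂_λ + γ^i_λ ∂_i^t)`, i.e. a connection on `J¹Q → Q`, given by
its horizontal lifts `T_q Q → T_v J¹Q ⊆ T_v TQ`, `v ∈ J¹Q`. Values of `γ` off `J¹Q` are
irrelevant. -/
structure IsDynamicConnection (π : Q → ℝ)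
    (γ : ∀ v : TangentBundle 𝓘(ℝ, E) Q,
      TangentSpace 𝓘(ℝ, E) v.proj →L[ℝ] TangentSpace (𝓘(ℝ, E).tangent) v) : Prop where
  smooth : SmoothLiftOn γ (J1 π)
  tangent : ∀ v ∈ J1 π, ∀ w, tddot π v (γ v w) = 0
  lift : ∀ v ∈ J1 π, ∀ w, Tproj v (γ v w) = w

/-- `γ` generates `ξ`: `ξ = ξ_γ`, the horizontal lift by `γ` of the total derivative
`d_t = ∂_t + q^i_t ∂_i`; in components `ξ^i = γ^i_0 + q^j_t γ^i_j`. -/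
def Generates (π : Q → ℝ)
    (γ : ∀ v : TangentBundle 𝓘(ℝ, E) Q,
      TangentSpace 𝓘(ℝ, E) v.proj →L[ℝ] TangentSpace (𝓘(ℝ, E).tangent) v)
    (ξ : ∀ v : TangentBundle 𝓘(ℝ, E) Q, TangentSpace (𝓘(ℝ, E).tangent) v) : Prop :=
  ∀ v ∈ J1 π, γ v v.2 = ξ v

/-- `γ` is the dynamic connection `γ_ξ` of `ξ`, with components
`γ^i_j = ½ ∂_j^t ξ^i` and `γ^i_0 = ξ^i - ½ q^j_t ∂_j^t ξ^i`. Contracted with a tangent vector `w`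
of `Q` this reads `γ^i_λ w^λ = dt(w) ξ^i + ½ u^j ∂_j^t ξ^i`, where `u = w - dt(w) v` is the vertical
part of `w`; note that `v + s u` stays in `J¹Q`. -/
def IsAssociatedConnection (π : Q → ℝ)
    (ξ : ∀ v : TangentBundle 𝓘(ℝ, E) Q, TangentSpace (𝓘(ℝ, E).tangent) v)
    (γ : ∀ v : TangentBundle 𝓘(ℝ, E) Q,
      TangentSpace 𝓘(ℝ, E) v.proj →L[ℝ] TangentSpace (𝓘(ℝ, E).tangent) v) : Prop :=
  ∀ φ ∈ IsManifold.maximalAtlas 𝓘(ℝ, E) ∞ Q,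
  ∀ (q : Q) (v w : TangentSpace 𝓘(ℝ, E) q), q ∈ φ.source →
    (⟨q, v⟩ : TangentBundle 𝓘(ℝ, E) Q) ∈ J1 π →
    qddot φ ⟨q, v⟩ (γ ⟨q, v⟩ w) =
      tdot π ⟨q, w⟩ • qddot φ ⟨q, v⟩ (ξ ⟨q, v⟩) +
      (1 / 2 : ℝ) • deriv (fun s : ℝ =>
        qddot φ ⟨q, v + s • (w - tdot π ⟨q, w⟩ • v)⟩
          (ξ ⟨q, v + s • (w - tdot π ⟨q, w⟩ • v)⟩)) 0

/-- The dynamic equation `q^i_tt = ξ^i`: the image of `ξ`, as a subset of `TTQ`. -/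
def dynamicEquation (π : Q → ℝ)
    (ξ : ∀ v : TangentBundle 𝓘(ℝ, E) Q, TangentSpace (𝓘(ℝ, E).tangent) v) :
    Set (TangentBundle 𝓘(ℝ, E).tangent (TangentBundle 𝓘(ℝ, E) Q)) :=
  (fun v => ⟨v, ξ v⟩) '' J1 π

/-- The system `ẗ = 0`, `ṫ = 1`, `q̈^μ = K^μ_λ q̇^λ`, as a subset of `TTQ`: the points with `ẗ = 0` and
`ṫ = 1` of the geodesic equation of `K`, which is the image of `v ↦ K v v`. -/
def geodesicEquation (π : Q → ℝ)
    (K : ∀ v : TangentBundle 𝓘(ℝ, E) Q,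
      TangentSpace 𝓘(ℝ, E) v.proj →L[ℝ] TangentSpace (𝓘(ℝ, E).tangent) v) :
    Set (TangentBundle 𝓘(ℝ, E).tangent (TangentBundle 𝓘(ℝ, E) Q)) :=
  {ζ | tddot π ζ.proj ζ.2 = 0 ∧ tdot π ζ.proj = 1 ∧ ζ ∈ range fun v =>
    (⟨v, K v v.2⟩ : TangentBundle 𝓘(ℝ, E).tangent (TangentBundle 𝓘(ℝ, E) Q))}

/-- The tangent prolongation `ċ` of a curve `c`. -/
def velocity (c : ℝ → Q) (s : ℝ) : TangentBundle 𝓘(ℝ, E) Q :=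
  ⟨c s, mfderiv 𝓘(ℝ, ℝ) 𝓘(ℝ, E) c s (1 : ℝ)⟩

/-- The second order tangent prolongation `c̈` of a curve `c`. -/
def acceleration (c : ℝ → Q) (s : ℝ) :
    TangentBundle 𝓘(ℝ, E).tangent (TangentBundle 𝓘(ℝ, E) Q) :=
  ⟨velocity c s, mfderiv 𝓘(ℝ, ℝ) 𝓘(ℝ, E).tangent (velocity (E := E) c) s (1 : ℝ)⟩

/-- The smooth curve `c : J → Q` is a solution of a second order equation `S ⊆ TTQ`. -/
def IsSolution (S : Set (TangentBundle 𝓘(ℝ, E).tangent (TangentBundle 𝓘(ℝ, E) Q)))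
    (J : Set ℝ) (c : ℝ → Q) : Prop :=
  ContMDiffOn 𝓘(ℝ, ℝ) 𝓘(ℝ, E) ∞ c J ∧ ∀ s ∈ J, acceleration c s ∈ S

/-- A motion of the dynamic equation `ξ` over `J`: a smooth section `c` of `π` over `J` whose second
order jet prolongation (in `J²Q ⊆ TTQ`) lies in the equation. -/
def IsMotion (π : Q → ℝ)
    (ξ : ∀ v : TangentBundle 𝓘(ℝ, E) Q, TangentSpace (𝓘(ℝ, E).tangent) v)
    (J : Set ℝ) (c : ℝ → Q) : Prop :=
  (∀ t ∈ J, π (c t) = t) ∧ IsSolution (dynamicEquation π ξ) J c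

end TimeBundle

end

/-!
A vector field `X` on `Q` with `dt(X) = 1` exists by a partition of unity, since `π` is a
submersion and `dt(X) = 1` is a convex condition. The translation along `X` taking the projection of
`v ∈ TQ` to `J¹Q` back to `v` preserves `ṫ` up to a constant, so its differential carries a dynamic
connection from `J¹Q` to a connection on `TQ` with `ẗ = 0`.

The components of `γ_ξ` are coordinate expressions. In a change of coordinates, `ξ^i` acquires the
term `∂_j∂_k q'^i q^j_t q^k_t`, quadratic in the velocities, and half the derivative of a quadratic
form along `u` is its polarization; hence the components transform as those of a connection.

On `J¹Q` the geodesic equation only sees the lift `K v v`, which is `ξ v`. Along its solutions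
`t = π(c(s))` has derivative `1`, so that `t = s + a`, and the equation does not depend on `s`.
-/

noncomputable section

namespace TimeBundle

section Differential

variable {V : Type*} [NormedAddCommGroup V] [NormedSpace ℝ V] {H : Type*} [TopologicalSpace H]
  {I : ModelWithCorners ℝ V H} {N : Type*} [TopologicalSpace N] [ChartedSpace H N]
  {G : Type*} [NormedAddCommGroup G] [NormedSpace ℝ G]
  {V' : Type*} [NormedAddCommGroup V'] [NormedSpace ℝ V'] {H' : Type*} [TopologicalSpace H']
  {I' : ModelWithCorners ℝ V' H'} {N' : Type*} [TopologicalSpace N'] [ChartedSpace H' N']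

/-- The differential `dg` of `g : N → G`, as a function on the tangent bundle. In particular
`tdot π` is `tangentDeriv π`, and `tangentDeriv φ` are the fibre coordinates induced by a
chart `φ`. -/
def tangentDeriv (g : N → G) (p : TangentBundle I N) : G := mfderiv I 𝓘(ℝ, G) g p.proj p.2

theorem tangentDeriv_add (g : N → G) {x : N} (v w : TangentSpace I x) :
    tangentDeriv g (⟨x, v + w⟩ : TangentBundle I N) =
      tangentDeriv g (⟨x, v⟩ : TangentBundle I N) + tangentDeriv g (⟨x, w⟩ : TangentBundle I N) :=
  map_add (mfderiv I 𝓘(ℝ, G) g x) v w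

theorem tangentDeriv_smul (g : N → G) {x : N} (c : ℝ) (v : TangentSpace I x) :
    tangentDeriv g (⟨x, c • v⟩ : TangentBundle I N) =
      c • tangentDeriv g (⟨x, v⟩ : TangentBundle I N) :=
  map_smul (mfderiv I 𝓘(ℝ, G) g x) c v

theorem tangentDeriv_congr {g g' : N → G} {p : TangentBundle I N} (h : g =ᶠ[𝓝 p.proj] g') :
    tangentDeriv g p = tangentDeriv g' p :=
  congrArg (fun L : V →L[ℝ] G => L p.2) h.mfderiv_eq

theorem tangentDeriv_comp {g : N → G} {f : N' → N} {p : TangentBundle I' N'}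
    (hg : MDifferentiableAt I 𝓘(ℝ, G) g (f p.proj)) (hf : MDifferentiableAt I' I f p.proj) :
    tangentDeriv (g ∘ f) p = tangentDeriv g (tangentMap I' I f p) :=
  congrArg (fun L => L p.2) (mfderiv_comp p.proj hg hf)

theorem hasMFDerivAt_clm_apply {G' : Type*} [NormedAddCommGroup G'] [NormedSpace ℝ G']
    {c : N → G →L[ℝ] G'} {u : N → G} {x : N} {c' : V →L[ℝ] G →L[ℝ] G'} {u' : V →L[ℝ] G}
    (hc : HasMFDerivAt I 𝓘(ℝ, G →L[ℝ] G') c x c') (hu : HasMFDerivAt I 𝓘(ℝ, G) u x u') :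
    HasMFDerivAt I 𝓘(ℝ, G') (fun y => c y (u y)) x ((c x).comp u' + c'.flip (u x)) :=
  (isBoundedBilinearMap_apply.hasFDerivAt (c x, u x)).hasMFDerivAt.comp x
    (f := fun y => (c y, u y)) (f' := c'.prod u') ⟨hc.1.prodMk hu.1, hc.2.prodMk hu.2⟩

theorem tangentDeriv_clm_apply {G' : Type*} [NormedAddCommGroup G'] [NormedSpace ℝ G']
    {c : N → G →L[ℝ] G'} {u : N → G} {p : TangentBundle I N}
    (hc : MDifferentiableAt I 𝓘(ℝ, G →L[ℝ] G') c p.proj)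
    (hu : MDifferentiableAt I 𝓘(ℝ, G) u p.proj) :
    tangentDeriv (fun x => c x (u x)) p =
      c p.proj (tangentDeriv u p) + tangentDeriv c p (u p.proj) :=
  congrArg (fun L : V →L[ℝ] G' => L p.2)
    (hasMFDerivAt_clm_apply hc.hasMFDerivAt hu.hasMFDerivAt).mfderiv

/-- The partial derivatives at `x` of `g : N → G` in the preferred chart around `x₀`. -/
def coordDeriv (I : ModelWithCorners ℝ V H) [IsManifold I 1 N] (g : N → G) (x₀ x : N) :
    V →L[ℝ] G :=
  inTangentCoordinates I 𝓘(ℝ, G) id g (mfderiv I 𝓘(ℝ, G) g) x₀ x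

theorem tangentDeriv_extChartAt_self [IsManifold I 1 N] (x : N) (w : TangentSpace I x) :
    tangentDeriv (extChartAt I x) (⟨x, w⟩ : TangentBundle I N) = w :=
  congrArg (fun L => (L w : V)) (mfderiv_extChartAt_self (I := I) (x := x))

theorem coordDeriv_eq_comp [IsManifold I 1 N] (g : N → G) {x₀ x : N}
    (hx : x ∈ (extChartAt I x₀).source) :
    coordDeriv I g x₀ x = mfderiv I 𝓘(ℝ, G) g x ∘L
      mfderivWithin 𝓘(ℝ, V) I (extChartAt I x₀).symm (range I) (extChartAt I x₀ x) := by
  rw [extChartAt_source] at hx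
  refine (inTangentCoordinates_eq_mfderiv_comp (I' := 𝓘(ℝ, G)) hx (mem_univ _)).trans ?_
  rw [extChartAt_model_space_eq_id]
  erw [mfderiv_id]
  exact ContinuousLinearMap.id_comp _

theorem tangentDeriv_eq_coordDeriv [IsManifold I 1 N] (g : N → G) {x₀ : N} {p : TangentBundle I N}
    (hp : p.proj ∈ (extChartAt I x₀).source) :
    tangentDeriv g p = coordDeriv I g x₀ p.proj (tangentDeriv (extChartAt I x₀) p) := by
  rw [coordDeriv_eq_comp g hp]
  exact congrArg (fun L => mfderiv I 𝓘(ℝ, G) g p.proj (L p.2))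
    (mfderivWithin_extChartAt_symm_comp_mfderiv_extChartAt' hp).symm

theorem coordDeriv_eq_fderiv [IsManifold I 1 N] [I.Boundaryless] {g : N → G} {x₀ x : N}
    (hx : x ∈ (extChartAt I x₀).source) (hg : MDifferentiableAt I 𝓘(ℝ, G) g x) :
    coordDeriv I g x₀ x = fderiv ℝ (g ∘ (extChartAt I x₀).symm) (extChartAt I x₀ x) := by
  have hs := mdifferentiableWithinAt_extChartAt_symm (I := I) ((extChartAt I x₀).map_source hx)
  rw [coordDeriv_eq_comp g hx]
  rw [I.range_eq_univ, mdifferentiableWithinAt_univ] at hs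
  rw [I.range_eq_univ, mfderivWithin_univ, ← mfderiv_eq_fderiv,
    mfderiv_comp _ (by rwa [(extChartAt I x₀).left_inv hx]) hs, (extChartAt I x₀).left_inv hx]

theorem coordDeriv_self_apply [IsManifold I 1 N] (g : N → G) (x : N) (w : TangentSpace I x) :
    coordDeriv I g x x w = tangentDeriv g (⟨x, w⟩ : TangentBundle I N) := by
  rw [tangentDeriv_eq_coordDeriv g (mem_extChartAt_source (I := I) x)]
  exact congrArg (coordDeriv I g x x) (tangentDeriv_extChartAt_self x w).symm

theorem contMDiffAt_coordDeriv [IsManifold I ∞ N] {g : N → G} {x₀ : N}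
    (hg : ContMDiffAt I 𝓘(ℝ, G) ∞ g x₀) :
    ContMDiffAt I 𝓘(ℝ, V →L[ℝ] G) ∞ (coordDeriv I g x₀) x₀ :=
  hg.mfderiv_const (by simp)

theorem tangentDeriv_extChartAt_eq_trivializationAt [IsManifold I 1 N] {x₀ : N}
    {p : TangentBundle I N} (hp : p.proj ∈ (chartAt H x₀).source) :
    tangentDeriv (extChartAt I x₀) p = (trivializationAt V (TangentSpace I) x₀ p).2 := by
  unfold tangentDeriv
  rw [← TangentBundle.continuousLinearMapAt_trivializationAt hp]
  erw [Bundle.Trivialization.continuousLinearMapAt_apply,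
    Bundle.Trivialization.coe_linearMapAt_of_mem _ hp]

theorem eventually_proj_mem [IsManifold I 1 N] {p : TangentBundle I N} {s : Set N}
    (hs : s ∈ 𝓝 p.proj) : ∀ᶠ p' : TangentBundle I N in 𝓝 p, p'.proj ∈ s :=
  (FiberBundle.continuous_proj V (TangentSpace I)).continuousAt.eventually hs

theorem inTangentCoordinates_apply_tangentDeriv {W : Type*} {f : W → N} {g : W → N'}
    [IsManifold I 1 N] [IsManifold I' 1 N']
    (L : ∀ y, TangentSpace I (f y) →L[ℝ] TangentSpace I' (g y)) {y₀ y : W}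
    (hf : f y ∈ (chartAt H (f y₀)).source) (hg : g y ∈ (chartAt H' (g y₀)).source)
    (w : TangentSpace I (f y)) :
    inTangentCoordinates I I' f g L y₀ y (tangentDeriv (extChartAt I (f y₀)) ⟨f y, w⟩) =
      tangentDeriv (extChartAt I' (g y₀)) (⟨g y, L y w⟩ : TangentBundle I' N') := by
  rw [← extChartAt_source I] at hf
  have hinv := mfderivWithin_extChartAt_symm_comp_mfderiv_extChartAt' hf
  rw [extChartAt_source] at hf
  rw [inTangentCoordinates_eq_mfderiv_comp hf hg]
  exact congrArg (fun A : V →L[ℝ] V => tangentDeriv (extChartAt I' (g y₀))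
    (⟨g y, L y (A w)⟩ : TangentBundle I' N')) hinv

theorem extChartAt_tangentBundle [IsManifold I 1 N] {p₀ p : TangentBundle I N}
    (hp : p.proj ∈ (chartAt H p₀.proj).source) :
    extChartAt I.tangent p₀ p =
      (extChartAt I p₀.proj p.proj, tangentDeriv (extChartAt I p₀.proj) p) := by
  rw [tangentDeriv_extChartAt_eq_trivializationAt hp]
  erw [FiberBundle.extChartAt]
  rfl

theorem contMDiffWithinAt_iff_tangentDeriv_extChartAt [IsManifold I ∞ N]
    {f : N' → TangentBundle I N} {S : Set N'} {x : N'} :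
    ContMDiffWithinAt I' I.tangent ∞ f S x ↔
      ContMDiffWithinAt I' I ∞ (fun y => (f y).proj) S x ∧
      ContMDiffWithinAt I' 𝓘(ℝ, V) ∞
        (fun y => tangentDeriv (extChartAt I (f x).proj) (f y)) S x := by
  rw [Bundle.contMDiffWithinAt_totalSpace]
  refine and_congr_right fun hf => ?_
  have hmem : ∀ᶠ y in 𝓝[S] x, (f y).proj ∈ (chartAt H (f x).proj).source :=
    hf.continuousWithinAt.eventually
      ((chartAt H (f x).proj).open_source.mem_nhds (mem_chart_source H _))
  exact Filter.EventuallyEq.contMDiffWithinAt_iff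
    (hmem.mono fun y hy => (tangentDeriv_extChartAt_eq_trivializationAt hy).symm)
    (tangentDeriv_extChartAt_eq_trivializationAt (mem_chart_source H _)).symm

theorem contMDiffAt_tangentDeriv [IsManifold I ∞ N] {g : N → G} {p : TangentBundle I N}
    (hg : ContMDiffAt I 𝓘(ℝ, G) ∞ g p.proj) :
    ContMDiffAt I.tangent 𝓘(ℝ, G) ∞ (tangentDeriv g) p := by
  have hid := contMDiffWithinAt_iff_tangentDeriv_extChartAt.1
    (contMDiffWithinAt_id (I := I.tangent) (s := univ) (x := p))
  refine (((contMDiffAt_coordDeriv hg).comp p (contMDiffWithinAt_univ.1 hid.1)).clm_apply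
    hid.2).congr_of_eventuallyEq ?_
  filter_upwards [eventually_proj_mem (extChartAt_source_mem_nhds (I := I) p.proj)] with p' hp'
  exact tangentDeriv_eq_coordDeriv g hp'

end Differential

variable {E : Type*} [NormedAddCommGroup E] [NormedSpace ℝ E]
  {Q : Type*} [TopologicalSpace Q] [ChartedSpace E Q] [IsManifold 𝓘(ℝ, E) ∞ Q]
  {G : Type*} [NormedAddCommGroup G] [NormedSpace ℝ G]

section SecondDifferential

/-- The second differential `d²g` of `g : Q → G`, as a function on the second tangent bundle. In
particular `tddot π` is `tangentDeriv₂ π`, and `qddot φ` is `tangentDeriv₂ φ`. -/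
def tangentDeriv₂ (g : Q → G) (v : TangentBundle 𝓘(ℝ, E) Q)
    (ζ : TangentSpace (𝓘(ℝ, E).tangent) v) : G :=
  tangentDeriv (tangentDeriv g)
    (⟨v, ζ⟩ : TangentBundle 𝓘(ℝ, E).tangent (TangentBundle 𝓘(ℝ, E) Q))

/-- The second partial derivatives at `q` of `g : Q → G` in the preferred chart around `q`. -/
def chartHessian (g : Q → G) (q : Q) : E →L[ℝ] E →L[ℝ] G :=
  mfderiv 𝓘(ℝ, E) 𝓘(ℝ, E →L[ℝ] G) (coordDeriv 𝓘(ℝ, E) g q) q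

theorem chartHessian_symm {g : Q → G} {q : Q} (hg : ContMDiffAt 𝓘(ℝ, E) 𝓘(ℝ, G) ∞ g q) (x y : E) :
    chartHessian g q x y = chartHessian g q y x := by
  set φ := extChartAt 𝓘(ℝ, E) q
  have hf : ContDiffAt ℝ ∞ (g ∘ φ.symm) (φ q) := by
    rw [contMDiffAt_iff_source, modelWithCornersSelf_coe, range_id, contMDiffWithinAt_univ,
      contMDiffAt_iff_contDiffAt] at hg
    exact hg
  have hcoord : coordDeriv 𝓘(ℝ, E) g q =ᶠ[𝓝 q] fderiv ℝ (g ∘ φ.symm) ∘ φ := by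
    have hg₁ : ContMDiffAt 𝓘(ℝ, E) 𝓘(ℝ, G) 1 g q := hg.of_le (by norm_num)
    have hg' := (contMDiffAt_iff_contMDiffAt_nhds (by norm_num)).1 hg₁
    filter_upwards [hg', extChartAt_source_mem_nhds (I := 𝓘(ℝ, E)) q] with q' hq' hφ
    exact coordDeriv_eq_fderiv hφ (hq'.mdifferentiableAt one_ne_zero)
  have hf' : MDifferentiableAt 𝓘(ℝ, E) 𝓘(ℝ, E →L[ℝ] G) (fderiv ℝ (g ∘ φ.symm)) (φ q) :=
    ((hf.fderiv_right (m := ∞) (by simp)).differentiableAt (by simp)).mdifferentiableAt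
  have hhess : chartHessian g q = fderiv ℝ (fderiv ℝ (g ∘ φ.symm)) (φ q) := by
    rw [chartHessian, hcoord.mfderiv_eq,
      mfderiv_comp q hf' (contMDiffAt_extChartAt.mdifferentiableAt one_ne_zero),
      mfderiv_extChartAt_self, mfderiv_eq_fderiv]
    exact ContinuousLinearMap.comp_id _
  rw [hhess]
  refine hf.isSymmSndFDerivAt ?_ x y
  rw [minSmoothness_of_isRCLikeNormedField]
  exact ENat.LEInfty.out

theorem mdifferentiableAt_proj (v : TangentBundle 𝓘(ℝ, E) Q) :
    MDifferentiableAt 𝓘(ℝ, E).tangent 𝓘(ℝ, E)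
      (Bundle.TotalSpace.proj : TangentBundle 𝓘(ℝ, E) Q → Q) v :=
  (Bundle.contMDiffAt_proj (n := 1) (TangentSpace 𝓘(ℝ, E))).mdifferentiableAt one_ne_zero

theorem tangentDeriv₂_eq {g : Q → G} {v : TangentBundle 𝓘(ℝ, E) Q}
    (hg : ContMDiffAt 𝓘(ℝ, E) 𝓘(ℝ, G) ∞ g v.proj) (ζ : TangentSpace 𝓘(ℝ, E).tangent v) :
    tangentDeriv₂ g v ζ =
      tangentDeriv g (⟨v.proj, tangentDeriv₂ (G := E) (extChartAt 𝓘(ℝ, E) v.proj) v ζ⟩ :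
        TangentBundle 𝓘(ℝ, E) Q) +
      chartHessian (E := E) g v.proj (Tproj v ζ) v.2 := by
  set φ : Q → E := ⇑(extChartAt 𝓘(ℝ, E) v.proj)
  have hφ : MDifferentiableAt 𝓘(ℝ, E).tangent 𝓘(ℝ, E) (tangentDeriv φ) v :=
    (contMDiffAt_tangentDeriv contMDiffAt_extChartAt).mdifferentiableAt (by simp)
  have hd : MDifferentiableAt 𝓘(ℝ, E) 𝓘(ℝ, E →L[ℝ] G) (coordDeriv 𝓘(ℝ, E) g v.proj) v.proj :=
    (contMDiffAt_coordDeriv hg).mdifferentiableAt (by simp)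
  have hcoord : tangentDeriv g =ᶠ[𝓝 v]
      fun p => (coordDeriv 𝓘(ℝ, E) g v.proj ∘ Bundle.TotalSpace.proj) p (tangentDeriv φ p) :=
    (eventually_proj_mem (extChartAt_source_mem_nhds (I := 𝓘(ℝ, E)) v.proj)).mono
      fun p hp => tangentDeriv_eq_coordDeriv g hp
  calc tangentDeriv₂ g v ζ
      = coordDeriv 𝓘(ℝ, E) g v.proj v.proj (tangentDeriv₂ φ v ζ) +
          chartHessian (E := E) g v.proj (Tproj v ζ) (tangentDeriv φ v) := by
        unfold tangentDeriv₂
        rw [tangentDeriv_congr hcoord,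
          tangentDeriv_clm_apply (hd.comp v (mdifferentiableAt_proj v)) hφ,
          tangentDeriv_comp hd (mdifferentiableAt_proj v)]
        rfl
    _ = _ := congrArg₂ (· + ·) (coordDeriv_self_apply g _ _)
        (congrArg (chartHessian (E := E) g v.proj (Tproj v ζ))
          (tangentDeriv_extChartAt_self v.proj v.2))

theorem tangentDeriv_extChartAt_tangentBundle {v₀ v : TangentBundle 𝓘(ℝ, E) Q}
    (hv : v.proj ∈ (chartAt E v₀.proj).source) (ζ : TangentSpace 𝓘(ℝ, E).tangent v) :
    tangentDeriv (extChartAt 𝓘(ℝ, E).tangent v₀)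
      (⟨v, ζ⟩ : TangentBundle 𝓘(ℝ, E).tangent (TangentBundle 𝓘(ℝ, E) Q)) =
      (tangentDeriv (extChartAt 𝓘(ℝ, E) v₀.proj) ⟨v.proj, Tproj v ζ⟩,
        tangentDeriv₂ (extChartAt 𝓘(ℝ, E) v₀.proj) v ζ) := by
  set φ : Q → E := ⇑(extChartAt 𝓘(ℝ, E) v₀.proj)
  have hφ : ContMDiffAt 𝓘(ℝ, E) 𝓘(ℝ, E) ∞ φ v.proj := contMDiffAt_extChartAt' hv
  have h₁ := (hφ.mdifferentiableAt (by simp)).hasMFDerivAt.comp v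
    (mdifferentiableAt_proj v).hasMFDerivAt
  have h₂ := ((contMDiffAt_tangentDeriv hφ).mdifferentiableAt (by simp)).hasMFDerivAt
  have hprod : mfderiv 𝓘(ℝ, E).tangent 𝓘(ℝ, E × E)
      (fun p : TangentBundle 𝓘(ℝ, E) Q => (φ p.proj, tangentDeriv φ p)) v = _ :=
    HasMFDerivAt.mfderiv ⟨h₁.1.prodMk h₂.1, h₁.2.prodMk h₂.2⟩
  have hcoord : ⇑(extChartAt 𝓘(ℝ, E).tangent v₀) =ᶠ[𝓝 v] fun p => (φ p.proj, tangentDeriv φ p) :=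
    (eventually_proj_mem ((chartAt E v₀.proj).open_source.mem_nhds hv)).mono
      fun p hp => extChartAt_tangentBundle hp
  rw [tangentDeriv_congr hcoord]
  exact congrArg (fun L : E × E →L[ℝ] E × E => L ζ) hprod

theorem eq_Tproj_tangentDeriv₂ {v : TangentBundle 𝓘(ℝ, E) Q} (ζ : TangentSpace 𝓘(ℝ, E).tangent v) :
    ζ = (Tproj v ζ, tangentDeriv₂ (G := E) (extChartAt 𝓘(ℝ, E) v.proj) v ζ) :=
  (tangentDeriv_extChartAt_self v ζ).symm.trans <|
    (tangentDeriv_extChartAt_tangentBundle (mem_chart_source E v.proj) ζ).trans <|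
    congrArg (Prod.mk · _) (tangentDeriv_extChartAt_self v.proj (Tproj v ζ))

variable {K : ∀ v : TangentBundle 𝓘(ℝ, E) Q,
  TangentSpace 𝓘(ℝ, E) v.proj →L[ℝ] TangentSpace (𝓘(ℝ, E).tangent) v}

theorem smoothLiftOn_iff_exists_components {S : Set (TangentBundle 𝓘(ℝ, E) Q)}
    (hK : ∀ v ∈ S, ∀ w, Tproj v (K v w) = w) :
    SmoothLiftOn K S ↔ ∀ v₀ ∈ S, ∃ k : TangentBundle 𝓘(ℝ, E) Q → E →L[ℝ] E,
      ContMDiffWithinAt 𝓘(ℝ, E).tangent 𝓘(ℝ, E →L[ℝ] E) ∞ k S v₀ ∧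
      ∀ᶠ v in 𝓝[S] v₀, ∀ w : TangentSpace 𝓘(ℝ, E) v.proj,
        tangentDeriv₂ (extChartAt 𝓘(ℝ, E) v₀.proj) v (K v w) =
          k v (tangentDeriv (extChartAt 𝓘(ℝ, E) v₀.proj)
            (⟨v.proj, w⟩ : TangentBundle 𝓘(ℝ, E) Q)) := by
  refine forall₂_congr fun v₀ hv₀ => ?_
  set L := inTangentCoordinates 𝓘(ℝ, E) 𝓘(ℝ, E).tangent
    (Bundle.TotalSpace.proj : TangentBundle 𝓘(ℝ, E) Q → Q) id K v₀
  set φ : Q → E := ⇑(extChartAt 𝓘(ℝ, E) v₀.proj)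
  have hL : ∀ᶠ v in 𝓝[S] v₀, ∀ w : TangentSpace 𝓘(ℝ, E) v.proj,
      L v (tangentDeriv φ (⟨v.proj, w⟩ : TangentBundle 𝓘(ℝ, E) Q)) =
        (tangentDeriv φ (⟨v.proj, w⟩ : TangentBundle 𝓘(ℝ, E) Q), tangentDeriv₂ φ v (K v w)) := by
    filter_upwards [nhdsWithin_le_nhds <| eventually_proj_mem (chart_source_mem_nhds E v₀.proj),
      self_mem_nhdsWithin] with v hv hvS w
    have := inTangentCoordinates_apply_tangentDeriv K hv (by simpa using hv) w
    refine this.trans <| (tangentDeriv_extChartAt_tangentBundle hv (K v w)).trans ?_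
    rw [hK v hvS w]
  constructor
  · intro hsmooth
    refine ⟨fun v => .comp (.snd ℝ E E) (L v), contMDiffWithinAt_const.clm_comp hsmooth, ?_⟩
    filter_upwards [hL] with v hv w
    exact (congrArg Prod.snd (hv w)).symm
  · rintro ⟨k, hk, h⟩
    have hsmooth : ContMDiffWithinAt 𝓘(ℝ, E).tangent 𝓘(ℝ, E →L[ℝ] E × E) ∞
        (fun v => .inl ℝ E E + (ContinuousLinearMap.inr ℝ E E).comp (k v)) S v₀ :=
      contMDiffWithinAt_const.add (contMDiffWithinAt_const.clm_comp hk)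
    refine hsmooth.congr_of_eventuallyEq_of_mem ?_ hv₀
    filter_upwards [h, hL, nhdsWithin_le_nhds <|
      eventually_proj_mem (extChartAt_source_mem_nhds (I := 𝓘(ℝ, E)) v₀.proj)] with v hkv hLv hv
    ext1 z
    obtain ⟨w, rfl⟩ := (isInvertible_mfderiv_extChartAt hv).surjective z
    have hprod (z : E) : (z, k v z) = (.inl ℝ E E + (.inr ℝ E E ∘L k v) : E →L[ℝ] E × E) z := by
      simp
    exact (hLv w).trans <| (congrArg (Prod.mk _) (hkv w)).trans (hprod _)

end SecondDifferential

section ReferenceFrame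

variable {π : Q → ℝ} {X : ∀ q : Q, TangentSpace 𝓘(ℝ, E) q}
  {γ : ∀ v : TangentBundle 𝓘(ℝ, E) Q,
    TangentSpace 𝓘(ℝ, E) v.proj →L[ℝ] TangentSpace (𝓘(ℝ, E).tangent) v}

/-- A reference frame on `π : Q → ℝ`, i.e. a connection `∂_t + X^i ∂_i` on `π`, given by its
horizontal vector field. It splits off the time direction in `TQ` globally. -/
structure IsReferenceFrame (π : Q → ℝ) (X : ∀ q : Q, TangentSpace 𝓘(ℝ, E) q) : Prop where
  contMDiff : ContMDiff 𝓘(ℝ, E) 𝓘(ℝ, E).tangent ∞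
    fun q => (⟨q, X q⟩ : TangentBundle 𝓘(ℝ, E) Q)
  tdot_eq_one : ∀ q, tdot π ⟨q, X q⟩ = 1

omit [IsManifold 𝓘(ℝ, E) ∞ Q] in
theorem convex_setOf_tdot_eq_one (π : Q → ℝ) (q : Q) :
    Convex ℝ {w : TangentSpace 𝓘(ℝ, E) q | tdot π ⟨q, w⟩ = 1} :=
  (convex_singleton (1 : ℝ)).is_linear_preimage
    (mfderiv 𝓘(ℝ, E) 𝓘(ℝ, ℝ) π q).toLinearMap.isLinear

theorem exists_local_referenceFrame (hπ : ContMDiff 𝓘(ℝ, E) 𝓘(ℝ, ℝ) ∞ π) {q : Q}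
    (hq : Function.Surjective (mfderiv 𝓘(ℝ, E) 𝓘(ℝ, ℝ) π q)) [FiniteDimensional ℝ E] [T2Space Q] :
    ∃ U ∈ 𝓝 q, ∃ Y : ∀ q : Q, TangentSpace 𝓘(ℝ, E) q,
      ContMDiffOn 𝓘(ℝ, E) 𝓘(ℝ, E).tangent ∞
        (fun q => (⟨q, Y q⟩ : TangentBundle 𝓘(ℝ, E) Q)) U ∧
      ∀ q ∈ U, tdot π ⟨q, Y q⟩ = 1 := by
  have : LocallyCompactSpace Q := Manifold.locallyCompact_of_finiteDimensional 𝓘(ℝ, E)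
  obtain ⟨w, hw⟩ := hq (1 : ℝ)
  set Y : ∀ q' : Q, TangentSpace 𝓘(ℝ, E) q' := FiberBundle.extend E w
  obtain ⟨U, hU, hY⟩ : ∃ U ∈ 𝓝 q, ContMDiffOn 𝓘(ℝ, E) 𝓘(ℝ, E).tangent ∞
      (fun q' => (⟨q', Y q'⟩ : TangentBundle 𝓘(ℝ, E) Q)) U :=
    FiberBundle.exists_contMDiffOn_extend 𝓘(ℝ, E) E w
  have htdot : ContMDiffOn 𝓘(ℝ, E) 𝓘(ℝ, ℝ) ∞ (fun q' => tdot π ⟨q', Y q'⟩) U := fun q' hq' =>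
    (contMDiffAt_tangentDeriv (p := ⟨q', Y q'⟩) hπ.contMDiffAt).comp_contMDiffWithinAt q'
      (hY q' hq')
  have hYq : tdot π ⟨q, Y q⟩ = 1 :=
    (congrArg (mfderiv 𝓘(ℝ, E) 𝓘(ℝ, ℝ) π q) (FiberBundle.extend_apply_self E w)).trans hw
  have hne : ∀ᶠ q' in 𝓝 q, tdot π ⟨q', Y q'⟩ ≠ 0 :=
    (htdot.continuousOn.continuousAt hU).eventually_ne (hYq ▸ one_ne_zero)
  refine ⟨U ∩ {q' | tdot π ⟨q', Y q'⟩ ≠ 0}, Filter.inter_mem hU hne,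
    (fun q' => (tdot π ⟨q', Y q'⟩)⁻¹) • Y, ?_, fun q' hq' => ?_⟩
  · exact ContMDiffOn.smul_section
      ((htdot.mono inter_subset_left).inv₀ fun q' hq' => hq'.2) (hY.mono inter_subset_left)
  · exact (tangentDeriv_smul π _ (Y q')).trans (inv_mul_cancel₀ hq'.2)

theorem exists_isReferenceFrame [FiniteDimensional ℝ E] [T2Space Q] [SecondCountableTopology Q]
    (hπ : ContMDiff 𝓘(ℝ, E) 𝓘(ℝ, ℝ) ∞ π)
    (hsurj : ∀ q, Function.Surjective (mfderiv 𝓘(ℝ, E) 𝓘(ℝ, ℝ) π q)) :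
    ∃ X : ∀ q : Q, TangentSpace 𝓘(ℝ, E) q, IsReferenceFrame π X := by
  have : LocallyCompactSpace Q := Manifold.locallyCompact_of_finiteDimensional 𝓘(ℝ, E)
  obtain ⟨X, hX⟩ := exists_contMDiffSection_forall_mem_convex_of_local (n := ⊤) (F_fiber := E)
    𝓘(ℝ, E) (TangentSpace 𝓘(ℝ, E) : Q → Type _) (fun q => {w | tdot π ⟨q, w⟩ = 1})
    (convex_setOf_tdot_eq_one π) fun q => exists_local_referenceFrame hπ (hsurj q)
  exact ⟨X, X.contMDiff, hX⟩

/-- The fibrewise translation of `TQ` by the multiple `f • X` of a vector field. -/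
def frameShift (X : ∀ q : Q, TangentSpace 𝓘(ℝ, E) q) (f : TangentBundle 𝓘(ℝ, E) Q → ℝ)
    (v : TangentBundle 𝓘(ℝ, E) Q) : TangentBundle 𝓘(ℝ, E) Q :=
  ⟨v.proj, v.2 + f v • X v.proj⟩

omit [IsManifold 𝓘(ℝ, E) ∞ Q] in
theorem tangentDeriv_frameShift (g : Q → G) (f : TangentBundle 𝓘(ℝ, E) Q → ℝ)
    (v : TangentBundle 𝓘(ℝ, E) Q) :
    tangentDeriv g (frameShift X f v) =
      tangentDeriv g v + f v • tangentDeriv g (⟨v.proj, X v.proj⟩ : TangentBundle 𝓘(ℝ, E) Q) :=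
  (tangentDeriv_add g v.2 _).trans (congrArg (_ + ·) (tangentDeriv_smul g _ _))

theorem contMDiffAt_tangentDeriv_section {g : Q → G} {q : Q}
    (hX : ContMDiffAt 𝓘(ℝ, E) 𝓘(ℝ, E).tangent ∞
      (fun q => (⟨q, X q⟩ : TangentBundle 𝓘(ℝ, E) Q)) q)
    (hg : ContMDiffAt 𝓘(ℝ, E) 𝓘(ℝ, G) ∞ g q) :
    ContMDiffAt 𝓘(ℝ, E) 𝓘(ℝ, G) ∞
      (fun q => tangentDeriv g (⟨q, X q⟩ : TangentBundle 𝓘(ℝ, E) Q)) q :=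
  (contMDiffAt_tangentDeriv (p := ⟨q, X q⟩) hg).comp q hX

theorem contMDiffAt_frameShift
    {f : TangentBundle 𝓘(ℝ, E) Q → ℝ} {v : TangentBundle 𝓘(ℝ, E) Q}
    (hX : ContMDiffAt 𝓘(ℝ, E) 𝓘(ℝ, E).tangent ∞
      (fun q => (⟨q, X q⟩ : TangentBundle 𝓘(ℝ, E) Q)) v.proj)
    (hf : ContMDiffAt 𝓘(ℝ, E).tangent 𝓘(ℝ, ℝ) ∞ f v) :
    ContMDiffAt 𝓘(ℝ, E).tangent 𝓘(ℝ, E).tangent ∞ (frameShift X f) v := by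
  have hproj := Bundle.contMDiffAt_proj (n := ∞) (IB := 𝓘(ℝ, E)) (p := v)
    (TangentSpace 𝓘(ℝ, E))
  rw [← contMDiffWithinAt_univ, contMDiffWithinAt_iff_tangentDeriv_extChartAt]
  simp only [contMDiffWithinAt_univ, tangentDeriv_frameShift]
  have hφ : ContMDiffAt 𝓘(ℝ, E) 𝓘(ℝ, E) ∞ (extChartAt 𝓘(ℝ, E) v.proj) v.proj :=
    contMDiffAt_extChartAt
  exact ⟨hproj, (contMDiffAt_tangentDeriv hφ).add
    (hf.smul ((contMDiffAt_tangentDeriv_section hX hφ).comp v hproj))⟩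

/-- The projection of `TQ` onto `J¹Q` along a reference frame. -/
def jetProjection (π : Q → ℝ) (X : ∀ q : Q, TangentSpace 𝓘(ℝ, E) q) :
    TangentBundle 𝓘(ℝ, E) Q → TangentBundle 𝓘(ℝ, E) Q :=
  frameShift X fun v => 1 - tdot π v

theorem jetProjection_mem_J1 (hX : IsReferenceFrame π X) (v : TangentBundle 𝓘(ℝ, E) Q) :
    jetProjection π X v ∈ J1 π := by
  have hX1 : tangentDeriv π (⟨v.proj, X v.proj⟩ : TangentBundle 𝓘(ℝ, E) Q) = 1 :=
    hX.tdot_eq_one v.proj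
  refine (tangentDeriv_frameShift π _ v).trans ?_
  rw [hX1, smul_eq_mul, mul_one]
  exact add_sub_cancel (tdot π v) 1

omit [IsManifold 𝓘(ℝ, E) ∞ Q] in
theorem jetProjection_of_mem_J1 {v : TangentBundle 𝓘(ℝ, E) Q} (hv : v ∈ J1 π) :
    jetProjection π X v = v := by
  have hv' : tdot π v = 1 := hv
  simp only [jetProjection, frameShift, hv', sub_self, zero_smul, add_zero]

theorem contMDiff_jetProjection (hπ : ContMDiff 𝓘(ℝ, E) 𝓘(ℝ, ℝ) ∞ π)
    (hX : ContMDiff 𝓘(ℝ, E) 𝓘(ℝ, E).tangent ∞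
      fun q => (⟨q, X q⟩ : TangentBundle 𝓘(ℝ, E) Q)) :
    ContMDiff 𝓘(ℝ, E).tangent 𝓘(ℝ, E).tangent ∞ (jetProjection π X) := fun v =>
  contMDiffAt_frameShift (hX v.proj) (contMDiffAt_const.sub (contMDiffAt_tangentDeriv (hπ v.proj)))

theorem tangentDeriv₂_mfderiv_frameShift (a : ℝ) {g : Q → G} {v : TangentBundle 𝓘(ℝ, E) Q}
    (hX : ContMDiffAt 𝓘(ℝ, E) 𝓘(ℝ, E).tangent ∞
      (fun q => (⟨q, X q⟩ : TangentBundle 𝓘(ℝ, E) Q)) v.proj)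
    (hg : ContMDiffAt 𝓘(ℝ, E) 𝓘(ℝ, G) ∞ g v.proj) (ζ : TangentSpace 𝓘(ℝ, E).tangent v) :
    tangentDeriv₂ g (frameShift X (fun _ => a) v)
        (mfderiv 𝓘(ℝ, E).tangent 𝓘(ℝ, E).tangent (frameShift X fun _ => a) v ζ) =
      tangentDeriv₂ g v ζ +
        a • tangentDeriv (fun q => tangentDeriv g (⟨q, X q⟩ : TangentBundle 𝓘(ℝ, E) Q))
          (⟨v.proj, Tproj v ζ⟩ : TangentBundle 𝓘(ℝ, E) Q) := by
  set S : TangentBundle 𝓘(ℝ, E) Q → TangentBundle 𝓘(ℝ, E) Q := frameShift X fun _ => a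
  set gX : Q → G := fun q => tangentDeriv g (⟨q, X q⟩ : TangentBundle 𝓘(ℝ, E) Q)
  have hdg {p : TangentBundle 𝓘(ℝ, E) Q} (hp : p.proj = v.proj) :
      MDifferentiableAt 𝓘(ℝ, E).tangent 𝓘(ℝ, G) (tangentDeriv g) p :=
    (contMDiffAt_tangentDeriv (hp ▸ hg)).mdifferentiableAt (by simp)
  have hS : MDifferentiableAt 𝓘(ℝ, E).tangent 𝓘(ℝ, E).tangent S v :=
    (contMDiffAt_frameShift hX contMDiffAt_const).mdifferentiableAt (by simp)
  have hgX : MDifferentiableAt 𝓘(ℝ, E) 𝓘(ℝ, G) gX v.proj :=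
    (contMDiffAt_tangentDeriv_section hX hg).mdifferentiableAt (by simp)
  have hsum := (hdg rfl).hasMFDerivAt.add
    ((hgX.comp v (mdifferentiableAt_proj v)).hasMFDerivAt.const_smul a)
  have hcomp : tangentDeriv g ∘ S = tangentDeriv g + a • (gX ∘ Bundle.TotalSpace.proj) :=
    funext (tangentDeriv_frameShift g _)
  calc _ = tangentDeriv (tangentDeriv g ∘ S)
        (⟨v, ζ⟩ : TangentBundle 𝓘(ℝ, E).tangent (TangentBundle 𝓘(ℝ, E) Q)) :=
        (tangentDeriv_comp (p := ⟨v, ζ⟩) (hdg rfl) hS).symm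
    _ = tangentDeriv₂ g v ζ + a • tangentDeriv (gX ∘ Bundle.TotalSpace.proj)
        (⟨v, ζ⟩ : TangentBundle 𝓘(ℝ, E).tangent (TangentBundle 𝓘(ℝ, E) Q)) := by
      rw [hcomp]
      exact congrArg (fun L : E × E →L[ℝ] G => L ζ) hsum.mfderiv
    _ = _ := congrArg (_ + a • ·) (tangentDeriv_comp (p := ⟨v, ζ⟩) hgX (mdifferentiableAt_proj v))

theorem Tproj_mfderiv_frameShift (a : ℝ) {v : TangentBundle 𝓘(ℝ, E) Q}
    (hX : ContMDiffAt 𝓘(ℝ, E) 𝓘(ℝ, E).tangent ∞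
      (fun q => (⟨q, X q⟩ : TangentBundle 𝓘(ℝ, E) Q)) v.proj)
    (ζ : TangentSpace 𝓘(ℝ, E).tangent v) :
    Tproj (frameShift X (fun _ => a) v)
      (mfderiv 𝓘(ℝ, E).tangent 𝓘(ℝ, E).tangent (frameShift X fun _ => a) v ζ) = Tproj v ζ :=
  have hS : MDifferentiableAt 𝓘(ℝ, E).tangent 𝓘(ℝ, E).tangent (frameShift X fun _ => a) v :=
    (contMDiffAt_frameShift hX contMDiffAt_const).mdifferentiableAt (by simp)
  congrArg (fun L : E × E →L[ℝ] E => L ζ) (mfderiv_comp v (mdifferentiableAt_proj _) hS).symm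

omit [IsManifold 𝓘(ℝ, E) ∞ Q] in
theorem frameShift_jetProjection (π : Q → ℝ) (X : ∀ q : Q, TangentSpace 𝓘(ℝ, E) q)
    (v : TangentBundle 𝓘(ℝ, E) Q) :
    frameShift X (fun _ => tdot π v - 1) (jetProjection π X v) = v :=
  congrArg (Bundle.TotalSpace.mk v.proj) (by module :
    v.2 + (1 - tdot π v) • X v.proj + (tdot π v - 1) • X v.proj = v.2)

/-- The extension to `TQ` of a connection `γ` on `J¹Q` along a reference frame `X`: the translation
along `X` which takes the projection of `v` to `J¹Q` back to `v` carries the horizontal lifts of `γ`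
with it. -/
def frameExtension (π : Q → ℝ) (X : ∀ q : Q, TangentSpace 𝓘(ℝ, E) q)
    (γ : ∀ v : TangentBundle 𝓘(ℝ, E) Q,
      TangentSpace 𝓘(ℝ, E) v.proj →L[ℝ] TangentSpace (𝓘(ℝ, E).tangent) v)
    (v : TangentBundle 𝓘(ℝ, E) Q) :
    TangentSpace 𝓘(ℝ, E) v.proj →L[ℝ] TangentSpace (𝓘(ℝ, E).tangent) v :=
  mfderiv 𝓘(ℝ, E).tangent 𝓘(ℝ, E).tangent (frameShift X fun _ => tdot π v - 1)
    (jetProjection π X v) ∘L γ (jetProjection π X v)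

theorem frameExtension_of_mem_J1 {v : TangentBundle 𝓘(ℝ, E) Q} (hv : v ∈ J1 π) :
    frameExtension π X γ v = γ v := by
  have hid {a : ℝ} (ha : a = 0) {p : TangentBundle 𝓘(ℝ, E) Q} (hp : p = v) :
      (mfderiv 𝓘(ℝ, E).tangent 𝓘(ℝ, E).tangent (frameShift X fun _ => a) p ∘L γ p :
        E →L[ℝ] E × E) = γ v := by
    subst ha hp
    have hshift : (frameShift X fun _ => 0) = (id : TangentBundle 𝓘(ℝ, E) Q → _) := by
      ext1 p
      simp only [frameShift, zero_smul, add_zero, id]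
    rw [hshift, mfderiv_id]
    exact ContinuousLinearMap.id_comp _
  exact hid (sub_eq_zero.2 hv) (jetProjection_of_mem_J1 hv)

theorem Tproj_frameExtension (hX : IsReferenceFrame π X)
    (hγ : ∀ v ∈ J1 π, ∀ w, Tproj v (γ v w) = w) (v : TangentBundle 𝓘(ℝ, E) Q)
    (w : TangentSpace 𝓘(ℝ, E) v.proj) :
    Tproj v (frameExtension π X γ v w) = w := by
  have h := Tproj_mfderiv_frameShift (tdot π v - 1) (hX.contMDiff v.proj)
    (v := jetProjection π X v) (γ (jetProjection π X v) w)
  rw [frameShift_jetProjection] at h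
  exact h.trans (hγ _ (jetProjection_mem_J1 hX v) w)

theorem tangentDeriv₂_frameExtension (hX : IsReferenceFrame π X)
    (hγ : ∀ v ∈ J1 π, ∀ w, Tproj v (γ v w) = w) {g : Q → G} {v : TangentBundle 𝓘(ℝ, E) Q}
    (hg : ContMDiffAt 𝓘(ℝ, E) 𝓘(ℝ, G) ∞ g v.proj) (w : TangentSpace 𝓘(ℝ, E) v.proj) :
    tangentDeriv₂ g v (frameExtension π X γ v w) =
      tangentDeriv₂ g (jetProjection π X v) (γ (jetProjection π X v) w) +
        (tdot π v - 1) • tangentDeriv (fun q => tangentDeriv g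
          (⟨q, X q⟩ : TangentBundle 𝓘(ℝ, E) Q)) (⟨v.proj, w⟩ : TangentBundle 𝓘(ℝ, E) Q) := by
  have h := tangentDeriv₂_mfderiv_frameShift (tdot π v - 1) (hX.contMDiff v.proj)
    (v := jetProjection π X v) hg (γ (jetProjection π X v) w)
  rw [frameShift_jetProjection, hγ _ (jetProjection_mem_J1 hX v) w] at h
  exact h

theorem tddot_frameExtension (hπ : ContMDiff 𝓘(ℝ, E) 𝓘(ℝ, ℝ) ∞ π) (hX : IsReferenceFrame π X)
    (hγ : IsDynamicConnection π γ) (v : TangentBundle 𝓘(ℝ, E) Q)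
    (w : TangentSpace 𝓘(ℝ, E) v.proj) : tddot π v (frameExtension π X γ v w) = 0 := by
  have hconst : (fun q => tangentDeriv π (⟨q, X q⟩ : TangentBundle 𝓘(ℝ, E) Q)) = fun _ => 1 :=
    funext hX.tdot_eq_one
  have hderiv :
      tangentDeriv (fun _ : Q => (1 : ℝ)) (⟨v.proj, w⟩ : TangentBundle 𝓘(ℝ, E) Q) = 0 := by
    rw [tangentDeriv, mfderiv_const]
    rfl
  refine (tangentDeriv₂_frameExtension hX hγ.lift (hπ v.proj) w).trans ?_
  rw [hconst, hderiv, smul_zero, add_zero]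
  exact hγ.tangent _ (jetProjection_mem_J1 hX v) w

theorem smoothLiftOn_frameExtension (hπ : ContMDiff 𝓘(ℝ, E) 𝓘(ℝ, ℝ) ∞ π)
    (hX : IsReferenceFrame π X) (hγ : IsDynamicConnection π γ) :
    SmoothLiftOn (frameExtension π X γ) univ := by
  rw [smoothLiftOn_iff_exists_components fun v _ => Tproj_frameExtension hX hγ.lift v]
  intro v₀ _
  obtain ⟨k, hk, hγk⟩ := (smoothLiftOn_iff_exists_components hγ.lift).1 hγ.smooth
    (jetProjection π X v₀) (jetProjection_mem_J1 hX v₀)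
  have hproj := contMDiff_jetProjection hπ hX.contMDiff v₀
  have hmaps : MapsTo (jetProjection π X) univ (J1 π) := fun v _ => jetProjection_mem_J1 hX v
  set φ : Q → E := ⇑(extChartAt 𝓘(ℝ, E) v₀.proj)
  set Xφ : Q → E := fun q => tangentDeriv φ (⟨q, X q⟩ : TangentBundle 𝓘(ℝ, E) Q)
  have hXφ : ContMDiffAt 𝓘(ℝ, E) 𝓘(ℝ, E) ∞ Xφ v₀.proj :=
    contMDiffAt_tangentDeriv_section (hX.contMDiff _) contMDiffAt_extChartAt
  refine ⟨fun v => k (jetProjection π X v) + (tdot π v - 1) • coordDeriv 𝓘(ℝ, E) Xφ v₀.proj v.proj,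
    (hk.comp v₀ hproj.contMDiffWithinAt hmaps).add (ContMDiffAt.contMDiffWithinAt
      (((contMDiffAt_tangentDeriv (hπ v₀.proj)).sub contMDiffAt_const).smul
        ((contMDiffAt_coordDeriv hXφ).comp v₀ (Bundle.contMDiffAt_proj _)))), ?_⟩
  have hsource := extChartAt_source_mem_nhds (I := 𝓘(ℝ, E)) v₀.proj
  filter_upwards [(hproj.continuousAt.continuousWithinAt.tendsto_nhdsWithin hmaps).eventually hγk,
    nhdsWithin_le_nhds (eventually_proj_mem hsource)] with v hv hvφ w
  exact (tangentDeriv₂_frameExtension hX hγ.lift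
    (contMDiffAt_extChartAt' (by simpa using hvφ)) w).trans <| congrArg₂ (· + ·) (hv w)
      (congrArg ((tdot π v - 1) • ·) (tangentDeriv_eq_coordDeriv Xφ hvφ))

theorem isConnection_frameExtension (hπ : ContMDiff 𝓘(ℝ, E) 𝓘(ℝ, ℝ) ∞ π)
    (hX : IsReferenceFrame π X) (hγ : IsDynamicConnection π γ) :
    IsConnection (frameExtension π X γ) where
  smooth := smoothLiftOn_frameExtension hπ hX hγ
  lift := Tproj_frameExtension hX hγ.lift

end ReferenceFrame

section AssociatedConnection

variable {π : Q → ℝ} {X : ∀ q : Q, TangentSpace 𝓘(ℝ, E) q}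
  {ξ : ∀ v : TangentBundle 𝓘(ℝ, E) Q, TangentSpace (𝓘(ℝ, E).tangent) v}

/-- The affine line through `v` in the direction `u` in a fibre of `TQ`. -/
def fiberLine (v : TangentBundle 𝓘(ℝ, E) Q) (u : TangentSpace 𝓘(ℝ, E) v.proj) (s : ℝ) :
    TangentBundle 𝓘(ℝ, E) Q :=
  ⟨v.proj, v.2 + s • u⟩

omit [IsManifold 𝓘(ℝ, E) ∞ Q] in
theorem fiberLine_zero (v : TangentBundle 𝓘(ℝ, E) Q) (u : TangentSpace 𝓘(ℝ, E) v.proj) :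
    fiberLine v u 0 = v := by
  simp only [fiberLine, zero_smul, add_zero]

omit [IsManifold 𝓘(ℝ, E) ∞ Q] in
theorem tangentDeriv_fiberLine (g : Q → G) (v : TangentBundle 𝓘(ℝ, E) Q)
    (u : TangentSpace 𝓘(ℝ, E) v.proj) (s : ℝ) :
    tangentDeriv g (fiberLine v u s) =
      tangentDeriv g v + s • tangentDeriv g (⟨v.proj, u⟩ : TangentBundle 𝓘(ℝ, E) Q) :=
  (tangentDeriv_add g v.2 _).trans (congrArg (_ + ·) (tangentDeriv_smul g _ _))

theorem mdifferentiableAt_fiberLine (v : TangentBundle 𝓘(ℝ, E) Q)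
    (u : TangentSpace 𝓘(ℝ, E) v.proj) :
    MDifferentiableAt 𝓘(ℝ, ℝ) 𝓘(ℝ, E).tangent (fiberLine v u) 0 := by
  refine ContMDiffAt.mdifferentiableAt (n := ∞) ?_ (by simp)
  rw [← contMDiffWithinAt_univ, contMDiffWithinAt_iff_tangentDeriv_extChartAt]
  simp only [contMDiffWithinAt_univ, tangentDeriv_fiberLine]
  exact ⟨contMDiffAt_const, contMDiffAt_const.add (contMDiffAt_id.smul contMDiffAt_const)⟩

/-- The vertical lift to `v` of a tangent vector `u` of `Q`: the velocity of the line through `v` in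
the direction `u`. -/
def verticalLift (v : TangentBundle 𝓘(ℝ, E) Q) (u : TangentSpace 𝓘(ℝ, E) v.proj) :
    TangentSpace 𝓘(ℝ, E).tangent v :=
  mfderiv 𝓘(ℝ, ℝ) 𝓘(ℝ, E).tangent (fiberLine v u) 0 (1 : ℝ)

theorem hasDerivAt_comp_fiberLine_verticalLift {h : TangentBundle 𝓘(ℝ, E) Q → G}
    {v : TangentBundle 𝓘(ℝ, E) Q} (hh : MDifferentiableAt 𝓘(ℝ, E).tangent 𝓘(ℝ, G) h v)
    (u : TangentSpace 𝓘(ℝ, E) v.proj) :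
    HasDerivAt (h ∘ fiberLine v u)
      (tangentDeriv h (⟨v, verticalLift v u⟩ : TangentBundle 𝓘(ℝ, E).tangent
        (TangentBundle 𝓘(ℝ, E) Q))) 0 := by
  rw [← fiberLine_zero v u] at hh
  have hderiv := hh.hasMFDerivAt.comp 0 (mdifferentiableAt_fiberLine v u).hasMFDerivAt
  rw [fiberLine_zero v u] at hderiv
  set L : ℝ →L[ℝ] G := mfderiv 𝓘(ℝ, E).tangent 𝓘(ℝ, G) h v ∘L
    mfderiv 𝓘(ℝ, ℝ) 𝓘(ℝ, E).tangent (fiberLine v u) 0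
  have hL : HasFDerivAt (h ∘ fiberLine v u) L 0 := hderiv.hasFDerivAt
  exact hL.hasDerivAt

theorem Tproj_verticalLift (v : TangentBundle 𝓘(ℝ, E) Q) (u : TangentSpace 𝓘(ℝ, E) v.proj) :
    Tproj v (verticalLift v u) = 0 := by
  have hconst : Bundle.TotalSpace.proj ∘ fiberLine v u = fun _ => v.proj := rfl
  have hcomp := mfderiv_comp (0 : ℝ) (mdifferentiableAt_proj (fiberLine v u 0))
    (mdifferentiableAt_fiberLine v u)
  rw [hconst, mfderiv_const, fiberLine_zero] at hcomp
  exact congrArg (fun L : ℝ →L[ℝ] E => L 1) hcomp.symm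

theorem tangentDeriv₂_verticalLift {g : Q → G} {v : TangentBundle 𝓘(ℝ, E) Q}
    (hg : ContMDiffAt 𝓘(ℝ, E) 𝓘(ℝ, G) ∞ g v.proj) (u : TangentSpace 𝓘(ℝ, E) v.proj) :
    tangentDeriv₂ g v (verticalLift v u) =
      tangentDeriv g (⟨v.proj, u⟩ : TangentBundle 𝓘(ℝ, E) Q) := by
  set gu : G := tangentDeriv g (⟨v.proj, u⟩ : TangentBundle 𝓘(ℝ, E) Q)
  have hline : HasDerivAt (fun s : ℝ => tangentDeriv g v + s • gu) ((1 : ℝ) • gu) 0 :=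
    ((hasDerivAt_id (0 : ℝ)).smul_const gu).const_add _
  have hlift := hasDerivAt_comp_fiberLine_verticalLift
    ((contMDiffAt_tangentDeriv hg).mdifferentiableAt (by simp)) u
  rw [show tangentDeriv g ∘ fiberLine v u = _ from funext (tangentDeriv_fiberLine g v u)] at hlift
  exact (hlift.unique hline).trans (one_smul ℝ gu)

/-- The partial derivatives at `v` of a function on `TQ` by the fibre coordinates `q̇^i` induced by
the preferred chart around the base point of `v₀`. -/
def fiberDeriv (h : TangentBundle 𝓘(ℝ, E) Q → G) (v₀ v : TangentBundle 𝓘(ℝ, E) Q) : E →L[ℝ] G :=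
  coordDeriv 𝓘(ℝ, E).tangent h v₀ v ∘L .inr ℝ E E

theorem contMDiffAt_fiberDeriv {h : TangentBundle 𝓘(ℝ, E) Q → G} {v₀ : TangentBundle 𝓘(ℝ, E) Q}
    (hh : ContMDiffAt 𝓘(ℝ, E).tangent 𝓘(ℝ, G) ∞ h v₀) :
    ContMDiffAt 𝓘(ℝ, E).tangent 𝓘(ℝ, E →L[ℝ] G) ∞ (fiberDeriv h v₀) v₀ :=
  (contMDiffAt_coordDeriv hh).clm_comp contMDiffAt_const

theorem hasDerivAt_comp_fiberLine {h : TangentBundle 𝓘(ℝ, E) Q → G}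
    {v₀ v : TangentBundle 𝓘(ℝ, E) Q} (hv : v.proj ∈ (chartAt E v₀.proj).source)
    (hh : MDifferentiableAt 𝓘(ℝ, E).tangent 𝓘(ℝ, G) h v) (u : TangentSpace 𝓘(ℝ, E) v.proj) :
    HasDerivAt (h ∘ fiberLine v u)
      (fiberDeriv h v₀ v (tangentDeriv (extChartAt 𝓘(ℝ, E) v₀.proj)
        (⟨v.proj, u⟩ : TangentBundle 𝓘(ℝ, E) Q))) 0 := by
  set φ : Q → E := ⇑(extChartAt 𝓘(ℝ, E) v₀.proj)
  have hv' : v ∈ (extChartAt 𝓘(ℝ, E).tangent v₀).source := by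
    simpa [extChartAt_source] using hv
  have hcoord : tangentDeriv (extChartAt 𝓘(ℝ, E).tangent v₀) (⟨v, verticalLift v u⟩ :
      TangentBundle 𝓘(ℝ, E).tangent (TangentBundle 𝓘(ℝ, E) Q)) =
      (0, tangentDeriv φ (⟨v.proj, u⟩ : TangentBundle 𝓘(ℝ, E) Q)) := by
    rw [tangentDeriv_extChartAt_tangentBundle hv, Tproj_verticalLift,
      tangentDeriv₂_verticalLift (contMDiffAt_extChartAt' hv)]
    exact congrArg (Prod.mk · _) (map_zero (mfderiv 𝓘(ℝ, E) 𝓘(ℝ, E) φ v.proj))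
  refine (hasDerivAt_comp_fiberLine_verticalLift hh u).congr_deriv ?_
  rw [tangentDeriv_eq_coordDeriv h hv', hcoord]
  rfl

/-- The vertical part `w - dt(w) v` of a tangent vector `w` of `Q`, for the splitting of the tangent
space of `Q` defined by `v ∈ J¹Q`. -/
def verticalPart (π : Q → ℝ) (v : TangentBundle 𝓘(ℝ, E) Q) (w : TangentSpace 𝓘(ℝ, E) v.proj) :
    TangentSpace 𝓘(ℝ, E) v.proj :=
  w - tdot π ⟨v.proj, w⟩ • v.2

omit [IsManifold 𝓘(ℝ, E) ∞ Q] in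
theorem tangentDeriv_verticalPart (g : Q → G) (v : TangentBundle 𝓘(ℝ, E) Q)
    (w : TangentSpace 𝓘(ℝ, E) v.proj) :
    tangentDeriv g (⟨v.proj, verticalPart π v w⟩ : TangentBundle 𝓘(ℝ, E) Q) =
      tangentDeriv g (⟨v.proj, w⟩ : TangentBundle 𝓘(ℝ, E) Q) -
        tdot π ⟨v.proj, w⟩ • tangentDeriv g v :=
  (map_sub (mfderiv 𝓘(ℝ, E) 𝓘(ℝ, G) g v.proj) w _).trans
    (congrArg (_ - ·) (tangentDeriv_smul g _ v.2))

omit [IsManifold 𝓘(ℝ, E) ∞ Q] in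
theorem fiberLine_verticalPart_self {v : TangentBundle 𝓘(ℝ, E) Q} (hv : v ∈ J1 π) (s : ℝ) :
    fiberLine v (verticalPart π v v.2) s = v := by
  have hv' : tdot π ⟨v.proj, v.2⟩ = 1 := hv
  simp only [fiberLine, verticalPart, hv', one_smul, sub_self, smul_zero, add_zero]

omit [IsManifold 𝓘(ℝ, E) ∞ Q] in
theorem fiberLine_verticalPart_mem_J1 {v : TangentBundle 𝓘(ℝ, E) Q} (hv : v ∈ J1 π)
    (w : TangentSpace 𝓘(ℝ, E) v.proj) (s : ℝ) : fiberLine v (verticalPart π v w) s ∈ J1 π := by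
  have hv' : tangentDeriv π v = 1 := hv
  have hvert : tangentDeriv π (⟨v.proj, verticalPart π v w⟩ : TangentBundle 𝓘(ℝ, E) Q) = 0 := by
    rw [tangentDeriv_verticalPart, hv', smul_eq_mul, mul_one]
    exact sub_self _
  refine (tangentDeriv_fiberLine π v _ s).trans ?_
  rw [hvert, smul_zero, add_zero, hv']

theorem IsHolonomicConnection.contMDiffWithinAt_tangentDeriv₂ (hξ : IsHolonomicConnection π ξ)
    {g : Q → G} {v₀ : TangentBundle 𝓘(ℝ, E) Q} (hv₀ : v₀ ∈ J1 π)
    (hg : ContMDiffAt 𝓘(ℝ, E) 𝓘(ℝ, G) ∞ g v₀.proj) :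
    ContMDiffWithinAt 𝓘(ℝ, E).tangent 𝓘(ℝ, G) ∞ (fun v => tangentDeriv₂ g v (ξ v)) (J1 π) v₀ :=
  (contMDiffAt_tangentDeriv (p := ⟨v₀, ξ v₀⟩)
    (contMDiffAt_tangentDeriv hg)).comp_contMDiffWithinAt v₀ (hξ.smooth v₀ hv₀)

/-- The components `ξ^i` of `ξ` in the preferred chart around `q`, extended from `J¹Q` to `TQ` along
a reference frame `X`. -/
def frameComponent (π : Q → ℝ) (X : ∀ q : Q, TangentSpace 𝓘(ℝ, E) q)
    (ξ : ∀ v : TangentBundle 𝓘(ℝ, E) Q, TangentSpace (𝓘(ℝ, E).tangent) v) (q : Q)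
    (v : TangentBundle 𝓘(ℝ, E) Q) : E :=
  tangentDeriv₂ (extChartAt 𝓘(ℝ, E) q) (jetProjection π X v) (ξ (jetProjection π X v))

theorem frameComponent_of_mem_J1 {v : TangentBundle 𝓘(ℝ, E) Q} (hv : v ∈ J1 π) (q : Q) :
    frameComponent π X ξ q v = tangentDeriv₂ (extChartAt 𝓘(ℝ, E) q) v (ξ v) := by
  rw [frameComponent, jetProjection_of_mem_J1 hv]

theorem contMDiffAt_frameComponent (hπ : ContMDiff 𝓘(ℝ, E) 𝓘(ℝ, ℝ) ∞ π)
    (hX : IsReferenceFrame π X) (hξ : IsHolonomicConnection π ξ) {v₀ : TangentBundle 𝓘(ℝ, E) Q}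
    (hv₀ : v₀ ∈ J1 π) :
    ContMDiffAt 𝓘(ℝ, E).tangent 𝓘(ℝ, E) ∞ (frameComponent π X ξ v₀.proj) v₀ := by
  rw [← contMDiffWithinAt_univ]
  exact (hξ.contMDiffWithinAt_tangentDeriv₂ hv₀ contMDiffAt_extChartAt).comp_of_eq
    (contMDiff_jetProjection hπ hX.contMDiff v₀).contMDiffWithinAt
    (fun v _ => jetProjection_mem_J1 hX v) (jetProjection_of_mem_J1 hv₀)

theorem eventually_hasDerivAt_fiberLine (hπ : ContMDiff 𝓘(ℝ, E) 𝓘(ℝ, ℝ) ∞ π)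
    (hX : IsReferenceFrame π X) (hξ : IsHolonomicConnection π ξ) {v₀ : TangentBundle 𝓘(ℝ, E) Q}
    (hv₀ : v₀ ∈ J1 π) :
    ∀ᶠ v in 𝓝[J1 π] v₀, ∀ w : TangentSpace 𝓘(ℝ, E) v.proj,
      HasDerivAt (fun s => tangentDeriv₂ (extChartAt 𝓘(ℝ, E) v₀.proj)
          (fiberLine v (verticalPart π v w) s) (ξ (fiberLine v (verticalPart π v w) s)))
        (fiberDeriv (frameComponent π X ξ v₀.proj) v₀ v (tangentDeriv (extChartAt 𝓘(ℝ, E) v₀.proj)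
          (⟨v.proj, verticalPart π v w⟩ : TangentBundle 𝓘(ℝ, E) Q))) 0 := by
  have hsmooth : ContMDiffAt 𝓘(ℝ, E).tangent 𝓘(ℝ, E) 1 (frameComponent π X ξ v₀.proj) v₀ :=
    (contMDiffAt_frameComponent hπ hX hξ hv₀).of_le (by norm_num)
  filter_upwards [nhdsWithin_le_nhds ((contMDiffAt_iff_contMDiffAt_nhds (by norm_num)).1 hsmooth),
    nhdsWithin_le_nhds (eventually_proj_mem (chart_source_mem_nhds E v₀.proj)),
    self_mem_nhdsWithin] with v hv hvs hvJ w
  refine (hasDerivAt_comp_fiberLine hvs (hv.mdifferentiableAt one_ne_zero)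
    (verticalPart π v w)).congr_of_eventuallyEq (.of_forall fun s => ?_)
  exact (frameComponent_of_mem_J1 (fiberLine_verticalPart_mem_J1 hvJ w s) v₀.proj).symm

theorem hasDerivAt_tangentDeriv₂_fiberLine (hξ : IsHolonomicConnection π ξ) {g : Q → G}
    {v : TangentBundle 𝓘(ℝ, E) Q} (hv : v ∈ J1 π) (hg : ContMDiffAt 𝓘(ℝ, E) 𝓘(ℝ, G) ∞ g v.proj)
    (w : TangentSpace 𝓘(ℝ, E) v.proj) {d : E}
    (hd : HasDerivAt (fun s => tangentDeriv₂ (extChartAt 𝓘(ℝ, E) v.proj)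
      (fiberLine v (verticalPart π v w) s) (ξ (fiberLine v (verticalPart π v w) s))) d 0) :
    HasDerivAt (fun s => tangentDeriv₂ g
        (fiberLine v (verticalPart π v w) s) (ξ (fiberLine v (verticalPart π v w) s)))
      (tangentDeriv g (⟨v.proj, d⟩ : TangentBundle 𝓘(ℝ, E) Q) +
        (2 : ℝ) • chartHessian (E := E) g v.proj (verticalPart π v w) v.2) 0 := by
  set u : E := verticalPart π v w
  set x : E := v.2
  set B : E →L[ℝ] E →L[ℝ] G := chartHessian g v.proj
  set L : E →L[ℝ] G := mfderiv 𝓘(ℝ, E) 𝓘(ℝ, G) g v.proj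
  have hline : HasDerivAt (fun s : ℝ => x + s • u) ((1 : ℝ) • u) 0 :=
    ((hasDerivAt_id (0 : ℝ)).smul_const u).const_add x
  have hquad := (B.hasFDerivAt.comp_hasDerivAt (0 : ℝ) hline).clm_apply hline
  refine (((L.hasFDerivAt.comp_hasDerivAt (0 : ℝ) hd).add hquad).congr_of_eventuallyEq
    (.of_forall fun s => ?_)).congr_deriv ?_
  · refine (tangentDeriv₂_eq (v := fiberLine v u s) hg _).trans ?_
    exact congrArg (fun z : E => L _ + B z (x + s • u))
      (hξ.holonomic _ (fiberLine_verticalPart_mem_J1 hv w s))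
  · have hsymm : B x u = B u x := chartHessian_symm hg x u
    simp only [Function.comp_apply, one_smul, zero_smul, add_zero, hsymm, two_smul]
    rfl

/-- The component along `g` of the lift of `w` to `v` by `γ_ξ`, i.e. `γ^i_λ w^λ` when `g` is the
coordinate `q^i`. -/
def associatedComponent (π : Q → ℝ)
    (ξ : ∀ v : TangentBundle 𝓘(ℝ, E) Q, TangentSpace (𝓘(ℝ, E).tangent) v) (g : Q → G)
    (v : TangentBundle 𝓘(ℝ, E) Q) (w : TangentSpace 𝓘(ℝ, E) v.proj) : G :=
  tdot π ⟨v.proj, w⟩ • tangentDeriv₂ g v (ξ v) +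
    (1 / 2 : ℝ) • deriv (fun s => tangentDeriv₂ g
      (fiberLine v (verticalPart π v w) s) (ξ (fiberLine v (verticalPart π v w) s))) 0

theorem tangentDeriv₂_eq_associatedComponent (hξ : IsHolonomicConnection π ξ) {g : Q → G}
    {v : TangentBundle 𝓘(ℝ, E) Q} (hv : v ∈ J1 π) (hg : ContMDiffAt 𝓘(ℝ, E) 𝓘(ℝ, G) ∞ g v.proj)
    {ζ : TangentSpace 𝓘(ℝ, E).tangent v} {w : TangentSpace 𝓘(ℝ, E) v.proj} (hw : Tproj v ζ = w)
    (hdiff : DifferentiableAt ℝ (fun s => tangentDeriv₂ (G := E) (extChartAt 𝓘(ℝ, E) v.proj)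
      (fiberLine v (verticalPart π v w) s) (ξ (fiberLine v (verticalPart π v w) s))) 0)
    (hζ : tangentDeriv₂ (extChartAt 𝓘(ℝ, E) v.proj) v ζ =
      associatedComponent π ξ (extChartAt 𝓘(ℝ, E) v.proj) v w) :
    tangentDeriv₂ g v ζ = associatedComponent π ξ g v w := by
  set a : ℝ := tdot π ⟨v.proj, w⟩
  set x : E := v.2
  set y : E := w
  set B : E →L[ℝ] E →L[ℝ] G := chartHessian g v.proj
  set L : E →L[ℝ] G := mfderiv 𝓘(ℝ, E) 𝓘(ℝ, G) g v.proj
  set ξφ : E := tangentDeriv₂ (G := E) (extChartAt 𝓘(ℝ, E) v.proj) v (ξ v)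
  set d : E := deriv (fun s => tangentDeriv₂ (G := E) (extChartAt 𝓘(ℝ, E) v.proj)
    (fiberLine v (verticalPart π v w) s) (ξ (fiberLine v (verticalPart π v w) s))) 0
  have hleft : tangentDeriv₂ g v ζ = L (a • ξφ + (1 / 2 : ℝ) • d) + B y x :=
    (tangentDeriv₂_eq hg ζ).trans (congrArg₂ (fun z z' => L z + B z' x) hζ hw)
  have hξg : tangentDeriv₂ g v (ξ v) = L ξφ + B x x :=
    (tangentDeriv₂_eq hg (ξ v)).trans (congrArg (fun z => L ξφ + B z x) (hξ.holonomic v hv))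
  have hderiv : deriv (fun s => tangentDeriv₂ g (fiberLine v (verticalPart π v w) s)
      (ξ (fiberLine v (verticalPart π v w) s))) 0 = L d + (2 : ℝ) • B (y - a • x) x :=
    (hasDerivAt_tangentDeriv₂_fiberLine hξ hv hg w hdiff.hasDerivAt).deriv
  rw [associatedComponent, hleft, hξg, hderiv]
  simp only [map_add, map_sub, map_smul, sub_apply, smul_apply]
  module

/-- The components `γ^i_λ` of `γ_ξ` in the preferred chart around the base point of `v₀`, as a
function of `v ∈ TQ`; off `J¹Q` they depend on the reference frame `X`. -/
def associatedCoeff (π : Q → ℝ) (X : ∀ q : Q, TangentSpace 𝓘(ℝ, E) q)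
    (ξ : ∀ v : TangentBundle 𝓘(ℝ, E) Q, TangentSpace (𝓘(ℝ, E).tangent) v)
    (v₀ v : TangentBundle 𝓘(ℝ, E) Q) : E →L[ℝ] E :=
  (coordDeriv 𝓘(ℝ, E) π v₀.proj v.proj).smulRight (frameComponent π X ξ v₀.proj v) +
    (1 / 2 : ℝ) • fiberDeriv (frameComponent π X ξ v₀.proj) v₀ v ∘L
      (.id ℝ E - (coordDeriv 𝓘(ℝ, E) π v₀.proj v.proj).smulRight
        (tangentDeriv (extChartAt 𝓘(ℝ, E) v₀.proj) v))

theorem contMDiffAt_associatedCoeff (hπ : ContMDiff 𝓘(ℝ, E) 𝓘(ℝ, ℝ) ∞ π)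
    (hX : IsReferenceFrame π X) (hξ : IsHolonomicConnection π ξ) {v₀ : TangentBundle 𝓘(ℝ, E) Q}
    (hv₀ : v₀ ∈ J1 π) :
    ContMDiffAt 𝓘(ℝ, E).tangent 𝓘(ℝ, E →L[ℝ] E) ∞ (associatedCoeff π X ξ v₀) v₀ := by
  have hcomp := contMDiffAt_frameComponent hπ hX hξ hv₀
  have hdπ : ContMDiffAt 𝓘(ℝ, E).tangent 𝓘(ℝ, E →L[ℝ] ℝ) ∞
      (fun v : TangentBundle 𝓘(ℝ, E) Q => coordDeriv 𝓘(ℝ, E) π v₀.proj v.proj) v₀ :=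
    (contMDiffAt_coordDeriv (hπ v₀.proj)).comp v₀ (Bundle.contMDiffAt_proj _)
  have hsmulRight {f : TangentBundle 𝓘(ℝ, E) Q → E}
      (hf : ContMDiffAt 𝓘(ℝ, E).tangent 𝓘(ℝ, E) ∞ f v₀) :
      ContMDiffAt 𝓘(ℝ, E).tangent 𝓘(ℝ, E →L[ℝ] E) ∞
        (fun v => (coordDeriv 𝓘(ℝ, E) π v₀.proj v.proj).smulRight (f v)) v₀ :=
    (contMDiffAt_const (c := ContinuousLinearMap.smulRightL ℝ E E)).clm_apply hdπ |>.clm_apply hf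
  have hhalf : ContMDiffAt 𝓘(ℝ, E).tangent 𝓘(ℝ, ℝ) ∞
      (fun _ : TangentBundle 𝓘(ℝ, E) Q => (1 / 2 : ℝ)) v₀ := contMDiffAt_const
  exact (hsmulRight hcomp).add <| hhalf.smul <| (contMDiffAt_fiberDeriv hcomp).clm_comp <|
    (contMDiffAt_const (c := ContinuousLinearMap.id ℝ E)).sub <|
      hsmulRight (contMDiffAt_tangentDeriv contMDiffAt_extChartAt)

theorem eventually_associatedCoeff_apply (hπ : ContMDiff 𝓘(ℝ, E) 𝓘(ℝ, ℝ) ∞ π)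
    (hX : IsReferenceFrame π X) (hξ : IsHolonomicConnection π ξ) {v₀ : TangentBundle 𝓘(ℝ, E) Q}
    (hv₀ : v₀ ∈ J1 π) :
    ∀ᶠ v in 𝓝[J1 π] v₀, ∀ w : TangentSpace 𝓘(ℝ, E) v.proj,
      associatedCoeff π X ξ v₀ v (tangentDeriv (extChartAt 𝓘(ℝ, E) v₀.proj)
        (⟨v.proj, w⟩ : TangentBundle 𝓘(ℝ, E) Q)) =
      associatedComponent π ξ (extChartAt 𝓘(ℝ, E) v₀.proj) v w := by
  filter_upwards [eventually_hasDerivAt_fiberLine hπ hX hξ hv₀, nhdsWithin_le_nhds <|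
    eventually_proj_mem (extChartAt_source_mem_nhds (I := 𝓘(ℝ, E)) v₀.proj),
    self_mem_nhdsWithin] with v hderiv hvs hvJ w
  have hdπ : coordDeriv 𝓘(ℝ, E) π v₀.proj v.proj (tangentDeriv (extChartAt 𝓘(ℝ, E) v₀.proj)
      (⟨v.proj, w⟩ : TangentBundle 𝓘(ℝ, E) Q)) = tdot π ⟨v.proj, w⟩ :=
    (tangentDeriv_eq_coordDeriv π (p := ⟨v.proj, w⟩) hvs).symm
  rw [associatedComponent, (hderiv w).deriv, tangentDeriv_verticalPart, associatedCoeff,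
    frameComponent_of_mem_J1 hvJ]
  simp only [add_apply, smul_apply, ContinuousLinearMap.comp_apply, sub_apply,
    ContinuousLinearMap.id_apply, ContinuousLinearMap.smulRight_apply, hdπ]

/-- The horizontal lifts of the dynamic connection `γ_ξ`. -/
def associatedLift (π : Q → ℝ) (X : ∀ q : Q, TangentSpace 𝓘(ℝ, E) q)
    (ξ : ∀ v : TangentBundle 𝓘(ℝ, E) Q, TangentSpace (𝓘(ℝ, E).tangent) v)
    (v : TangentBundle 𝓘(ℝ, E) Q) :
    TangentSpace 𝓘(ℝ, E) v.proj →L[ℝ] TangentSpace (𝓘(ℝ, E).tangent) v :=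
  show E →L[ℝ] E × E from .prod (.id ℝ E) (associatedCoeff π X ξ v v)

theorem Tproj_associatedLift (v : TangentBundle 𝓘(ℝ, E) Q) (w : TangentSpace 𝓘(ℝ, E) v.proj) :
    Tproj v (associatedLift π X ξ v w) = w :=
  (congrArg Prod.fst (eq_Tproj_tangentDeriv₂ (associatedLift π X ξ v w))).symm

theorem tangentDeriv₂_associatedLift (hπ : ContMDiff 𝓘(ℝ, E) 𝓘(ℝ, ℝ) ∞ π)
    (hX : IsReferenceFrame π X) (hξ : IsHolonomicConnection π ξ) {g : Q → G}
    {v : TangentBundle 𝓘(ℝ, E) Q} (hv : v ∈ J1 π) (hg : ContMDiffAt 𝓘(ℝ, E) 𝓘(ℝ, G) ∞ g v.proj)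
    (w : TangentSpace 𝓘(ℝ, E) v.proj) :
    tangentDeriv₂ g v (associatedLift π X ξ v w) = associatedComponent π ξ g v w := by
  have hderiv := (eventually_hasDerivAt_fiberLine hπ hX hξ hv).self_of_nhdsWithin hv w
  refine tangentDeriv₂_eq_associatedComponent hξ hv hg (Tproj_associatedLift v w)
    hderiv.differentiableAt ?_
  rw [← (eventually_associatedCoeff_apply hπ hX hξ hv).self_of_nhdsWithin hv w,
    tangentDeriv_extChartAt_self]
  exact (congrArg Prod.snd (eq_Tproj_tangentDeriv₂ (associatedLift π X ξ v w))).symm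

theorem isDynamicConnection_associatedLift (hπ : ContMDiff 𝓘(ℝ, E) 𝓘(ℝ, ℝ) ∞ π)
    (hX : IsReferenceFrame π X) (hξ : IsHolonomicConnection π ξ) :
    IsDynamicConnection π (associatedLift π X ξ) where
  smooth := by
    rw [smoothLiftOn_iff_exists_components fun v _ => Tproj_associatedLift v]
    refine fun v₀ hv₀ => ⟨associatedCoeff π X ξ v₀,
      (contMDiffAt_associatedCoeff hπ hX hξ hv₀).contMDiffWithinAt, ?_⟩
    filter_upwards [eventually_associatedCoeff_apply hπ hX hξ hv₀, nhdsWithin_le_nhds <|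
      eventually_proj_mem (chart_source_mem_nhds E v₀.proj), self_mem_nhdsWithin]
      with v hcoeff hvs hvJ w
    exact (tangentDeriv₂_associatedLift hπ hX hξ hvJ (contMDiffAt_extChartAt' hvs) w).trans
      (hcoeff w).symm
  tangent v hv w := by
    have hzero : (fun s => tangentDeriv₂ π (fiberLine v (verticalPart π v w) s)
        (ξ (fiberLine v (verticalPart π v w) s))) = fun _ => 0 :=
      funext fun s => hξ.tangent _ (fiberLine_verticalPart_mem_J1 hv w s)
    have hξv : tangentDeriv₂ π v (ξ v) = 0 := hξ.tangent v hv
    refine (tangentDeriv₂_associatedLift hπ hX hξ hv (hπ v.proj) w).trans ?_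
    rw [associatedComponent, hzero, hξv, deriv_const, smul_zero, smul_zero, add_zero]
  lift v _ := Tproj_associatedLift v

theorem isAssociatedConnection_associatedLift (hπ : ContMDiff 𝓘(ℝ, E) 𝓘(ℝ, ℝ) ∞ π)
    (hX : IsReferenceFrame π X) (hξ : IsHolonomicConnection π ξ) :
    IsAssociatedConnection π ξ (associatedLift π X ξ) := fun _ hφ _ _ w hq hv =>
  tangentDeriv₂_associatedLift hπ hX hξ hv ((contMDiffOn_of_mem_maximalAtlas hφ).contMDiffAt
    ((OpenPartialHomeomorph.open_source _).mem_nhds hq)) w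

theorem generates_associatedLift (hπ : ContMDiff 𝓘(ℝ, E) 𝓘(ℝ, ℝ) ∞ π)
    (hX : IsReferenceFrame π X) (hξ : IsHolonomicConnection π ξ) :
    Generates π (associatedLift π X ξ) ξ := fun v hv => by
  have hv' : tdot π ⟨v.proj, v.2⟩ = 1 := hv
  have hsnd : tangentDeriv₂ (G := E) (extChartAt 𝓘(ℝ, E) v.proj) v (associatedLift π X ξ v v.2) =
      tangentDeriv₂ (extChartAt 𝓘(ℝ, E) v.proj) v (ξ v) := by
    have hconst := funext fun s => congrArg (fun p => tangentDeriv₂ (G := E)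
      (extChartAt 𝓘(ℝ, E) v.proj) p (ξ p)) (fiberLine_verticalPart_self hv s)
    refine (tangentDeriv₂_associatedLift hπ hX hξ hv contMDiffAt_extChartAt v.2).trans ?_
    rw [associatedComponent, hconst, deriv_const, hv', one_smul, smul_zero, add_zero]
  rw [eq_Tproj_tangentDeriv₂ (associatedLift π X ξ v v.2), eq_Tproj_tangentDeriv₂ (ξ v),
    Tproj_associatedLift, hξ.holonomic v hv, hsnd]

end AssociatedConnection

section GeodesicEquation

variable {π : Q → ℝ} {ξ : ∀ v : TangentBundle 𝓘(ℝ, E) Q, TangentSpace (𝓘(ℝ, E).tangent) v}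
  {K : ∀ v : TangentBundle 𝓘(ℝ, E) Q,
    TangentSpace 𝓘(ℝ, E) v.proj →L[ℝ] TangentSpace (𝓘(ℝ, E).tangent) v}
  {S : Set (TangentBundle 𝓘(ℝ, E).tangent (TangentBundle 𝓘(ℝ, E) Q))} {J : Set ℝ} {c : ℝ → Q}

theorem geodesicEquation_eq_dynamicEquation (hξ : IsHolonomicConnection π ξ)
    (hK : ∀ v ∈ J1 π, K v v.2 = ξ v) : geodesicEquation π K = dynamicEquation π ξ := by
  ext ζ
  constructor
  · rintro ⟨-, hv, v, rfl⟩
    exact ⟨v, hv, by simp only [hK v hv]⟩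
  · rintro ⟨v, hv, rfl⟩
    exact ⟨hξ.tangent v hv, hv, v, by simp only [hK v hv]⟩

theorem mfderiv_comp_sub_const {E' : Type*} [NormedAddCommGroup E'] [NormedSpace ℝ E']
    {H : Type*} [TopologicalSpace H] {I : ModelWithCorners ℝ E' H}
    {N : Type*} [TopologicalSpace N] [ChartedSpace H N] (c : ℝ → N) (a s : ℝ) :
    mfderiv 𝓘(ℝ, ℝ) I (fun s => c (s - a)) s (1 : ℝ) =
      mfderiv 𝓘(ℝ, ℝ) I c (s - a) (1 : ℝ) := by
  have hsub (b r : ℝ) : HasMFDerivAt 𝓘(ℝ, ℝ) 𝓘(ℝ, ℝ) (fun s : ℝ => s - b) r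
      (ContinuousLinearMap.id ℝ ℝ) := ((hasFDerivAt_id r).sub_const b).hasMFDerivAt
  by_cases hc : MDifferentiableAt 𝓘(ℝ, ℝ) I c (s - a)
  · exact congrArg (fun L => (L (1 : ℝ) : E')) (hc.hasMFDerivAt.comp s (hsub a s)).mfderiv
  · have hc' : ¬ MDifferentiableAt 𝓘(ℝ, ℝ) I (fun s => c (s - a)) s := fun hshift => hc <| by
      have hback : MDifferentiableAt 𝓘(ℝ, ℝ) I (fun s => c (s - a)) (s - a - -a) := by
        simpa using hshift
      simpa [Function.comp_def] using hback.comp (s - a) (hsub (-a) (s - a)).mdifferentiableAt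
    rw [mfderiv_zero_of_not_mdifferentiableAt hc, mfderiv_zero_of_not_mdifferentiableAt hc']
    rfl

omit [IsManifold 𝓘(ℝ, E) ∞ Q] in
theorem velocity_comp_sub_const (c : ℝ → Q) (a s : ℝ) :
    velocity (E := E) (fun s => c (s - a)) s = velocity c (s - a) :=
  congrArg (Bundle.TotalSpace.mk (c (s - a))) (mfderiv_comp_sub_const c a s)

theorem acceleration_comp_sub_const (c : ℝ → Q) (a s : ℝ) :
    acceleration (E := E) (fun s => c (s - a)) s = acceleration c (s - a) := by
  have hvelocity : velocity (E := E) (fun s => c (s - a)) = fun s => velocity c (s - a) :=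
    funext (velocity_comp_sub_const c a)
  rw [acceleration, hvelocity, mfderiv_comp_sub_const (I := 𝓘(ℝ, E).tangent) (velocity c) a s]
  rfl

theorem IsSolution.comp_sub_const (h : IsSolution S J c) (a : ℝ) :
    IsSolution S ((fun s => s - a) ⁻¹' J) fun s => c (s - a) :=
  ⟨h.1.comp (contDiff_id.sub contDiff_const).contMDiff.contMDiffOn fun _ hs => hs,
    fun s hs => (acceleration_comp_sub_const (E := E) c a s).symm ▸ h.2 _ hs⟩

omit [IsManifold 𝓘(ℝ, E) ∞ Q] in
theorem hasDerivAt_comp_of_tdot (hπ : ContMDiff 𝓘(ℝ, E) 𝓘(ℝ, ℝ) ∞ π) {s : ℝ}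
    (hc : MDifferentiableAt 𝓘(ℝ, ℝ) 𝓘(ℝ, E) c s) :
    HasDerivAt (fun s => π (c s)) (tdot π (velocity (E := E) c s)) s := by
  set L : ℝ →L[ℝ] ℝ := (mfderiv 𝓘(ℝ, E) 𝓘(ℝ, ℝ) π (c s)).comp (mfderiv 𝓘(ℝ, ℝ) 𝓘(ℝ, E) c s)
  have hL : HasFDerivAt (fun s => π (c s)) L s :=
    (((hπ (c s)).mdifferentiableAt (by simp)).hasMFDerivAt.comp s hc.hasMFDerivAt).hasFDerivAt
  exact hL.hasDerivAt

omit [IsManifold 𝓘(ℝ, E) ∞ Q] in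
theorem exists_forall_eq_add_of_tdot_eq_one (hπ : ContMDiff 𝓘(ℝ, E) 𝓘(ℝ, ℝ) ∞ π)
    (hJ : IsOpen J) (hJc : J.OrdConnected) (hc : ContMDiffOn 𝓘(ℝ, ℝ) 𝓘(ℝ, E) ∞ c J)
    (htdot : ∀ s ∈ J, tdot π (velocity (E := E) c s) = 1) :
    ∃ a : ℝ, ∀ s ∈ J, π (c s) = s + a := by
  have hderiv : ∀ s ∈ J, HasDerivAt (fun s => π (c s) - s) 0 s := fun s hs => by
    have hcs := (hc.contMDiffAt (hJ.mem_nhds hs)).mdifferentiableAt (by simp)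
    have hsub := (hasDerivAt_comp_of_tdot hπ hcs).sub (hasDerivAt_id s)
    rwa [htdot s hs, sub_self] at hsub
  obtain ⟨a, ha⟩ := hJ.exists_is_const_of_deriv_eq_zero hJc.isPreconnected
    (fun s hs => (hderiv s hs).differentiableAt.differentiableWithinAt)
    fun s hs => (hderiv s hs).deriv
  exact ⟨a, fun s hs => by linarith [ha s hs]⟩

theorem isSolution_iff_exists_shift (hπ : ContMDiff 𝓘(ℝ, E) 𝓘(ℝ, ℝ) ∞ π)
    (hS : ∀ ζ ∈ S, ζ.proj ∈ J1 π) (hJ : IsOpen J) (hJc : J.OrdConnected) :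
    IsSolution S J c ↔ ∃ a : ℝ, (∀ t ∈ (fun s => s - a) ⁻¹' J, π (c (t - a)) = t) ∧
      IsSolution S ((fun s => s - a) ⁻¹' J) fun s => c (s - a) := by
  constructor
  · intro h
    obtain ⟨a, ha⟩ := exists_forall_eq_add_of_tdot_eq_one hπ hJ hJc h.1 fun s hs => hS _ (h.2 s hs)
    exact ⟨a, fun t ht => by rw [ha _ ht, sub_add_cancel], h.comp_sub_const a⟩
  · rintro ⟨a, -, h⟩
    simpa [Set.preimage_preimage] using h.comp_sub_const (-a)

end GeodesicEquation

section SmoothBundle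

variable {F : Type*} [NormedAddCommGroup F] [NormedSpace ℝ F]
  {M : Type*} [TopologicalSpace M] [ChartedSpace F M] {π : Q → ℝ}

omit [IsManifold 𝓘(ℝ, E) ∞ Q] in
theorem IsSmoothBundle.contMDiff (hπ : IsSmoothBundle (E := E) F M π) :
    ContMDiff 𝓘(ℝ, E) 𝓘(ℝ, ℝ) ∞ π := fun q => by
  obtain ⟨e, hbase, hsmooth, -⟩ := hπ (π q)
  have hsource := e.open_source.mem_nhds (e.mem_source.2 hbase)
  refine (hsmooth.contMDiffAt hsource).fst.congr_of_eventuallyEq ?_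
  filter_upwards [hsource] with y hy using (e.coe_fst hy).symm

theorem surjective_mfderiv_of_eventually_rightInverse
    {E₁ : Type*} [NormedAddCommGroup E₁] [NormedSpace ℝ E₁]
    {H₁ : Type*} [TopologicalSpace H₁] {I₁ : ModelWithCorners ℝ E₁ H₁}
    {N₁ : Type*} [TopologicalSpace N₁] [ChartedSpace H₁ N₁]
    {E₂ : Type*} [NormedAddCommGroup E₂] [NormedSpace ℝ E₂]
    {H₂ : Type*} [TopologicalSpace H₂] {I₂ : ModelWithCorners ℝ E₂ H₂}
    {N₂ : Type*} [TopologicalSpace N₂] [ChartedSpace H₂ N₂]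
    {f : N₁ → N₂} {σ : N₂ → N₁} {y : N₂} (hf : MDifferentiableAt I₁ I₂ f (σ y))
    (hσ : MDifferentiableAt I₂ I₁ σ y) (hfσ : f ∘ σ =ᶠ[𝓝 y] id) :
    Function.Surjective (mfderiv I₁ I₂ f (σ y)) := fun w => by
  have hcomp := mfderiv_comp y hf hσ
  rw [hfσ.mfderiv_eq, mfderiv_id] at hcomp
  exact ⟨mfderiv I₂ I₁ σ y w, (congrArg (fun L => (L w : E₂)) hcomp).symm⟩

omit [IsManifold 𝓘(ℝ, E) ∞ Q] in
theorem IsSmoothBundle.surjective_mfderiv (hπ : IsSmoothBundle (E := E) F M π) (q : Q) :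
    Function.Surjective (mfderiv 𝓘(ℝ, E) 𝓘(ℝ, ℝ) π q) := by
  obtain ⟨e, hbase, -, hsmooth⟩ := hπ (π q)
  set σ : ℝ → Q := fun s => e.toOpenPartialHomeomorph.symm (s, (e q).2)
  have hσq : σ (π q) = q := e.symm_apply_mk_proj (e.mem_source.2 hbase)
  have hσ : ContMDiffAt 𝓘(ℝ, ℝ) 𝓘(ℝ, E) ∞ σ (π q) :=
    (hsmooth.contMDiffAt (e.open_target.mem_nhds (e.mem_target.2 hbase))).comp (π q)
      (contMDiffAt_id.prodMk contMDiffAt_const)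
  have hπσ : π ∘ σ =ᶠ[𝓝 (π q)] id := by
    filter_upwards [e.open_baseSet.mem_nhds hbase] with s hs
      using e.proj_symm_apply (e.mem_target.2 hs)
  have hsurj := surjective_mfderiv_of_eventually_rightInverse
    (hπ.contMDiff.contMDiffAt.mdifferentiableAt (by simp)) (hσ.mdifferentiableAt (by simp)) hπσ
  rwa [hσq] at hsurj

end SmoothBundle

end TimeBundle

end

open TimeBundle in
theorem theorem5p2_general
    {E : Type*} [NormedAddCommGroup E] [NormedSpace ℝ E] [FiniteDimensional ℝ E]
    {Q : Type*} [TopologicalSpace Q] [ChartedSpace E Q] [IsManifold 𝓘(ℝ, E) ∞ Q]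
    [T2Space Q] [SecondCountableTopology Q]
    (π : Q → ℝ) (hπ : ContMDiff 𝓘(ℝ, E) 𝓘(ℝ, ℝ) ∞ π)
    (hsurj : ∀ q, Function.Surjective (mfderiv 𝓘(ℝ, E) 𝓘(ℝ, ℝ) π q))
    (ξ : ∀ v : TangentBundle 𝓘(ℝ, E) Q, TangentSpace (𝓘(ℝ, E).tangent) v)
    (hξ : IsHolonomicConnection π ξ) :
    (∃ γ : ∀ v : TangentBundle 𝓘(ℝ, E) Q,
        TangentSpace 𝓘(ℝ, E) v.proj →L[ℝ] TangentSpace (𝓘(ℝ, E).tangent) v,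
      IsDynamicConnection π γ ∧ IsAssociatedConnection π ξ γ ∧ Generates π γ ξ) ∧
    (∀ γ : ∀ v : TangentBundle 𝓘(ℝ, E) Q,
        TangentSpace 𝓘(ℝ, E) v.proj →L[ℝ] TangentSpace (𝓘(ℝ, E).tangent) v,
      IsDynamicConnection π γ →
      ∃ K : ∀ v : TangentBundle 𝓘(ℝ, E) Q,
          TangentSpace 𝓘(ℝ, E) v.proj →L[ℝ] TangentSpace (𝓘(ℝ, E).tangent) v,
        IsConnection K ∧ (∀ v w, tddot π v (K v w) = 0) ∧ ∀ v ∈ J1 π, K v = γ v) ∧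
    ∀ K : ∀ v : TangentBundle 𝓘(ℝ, E) Q,
        TangentSpace 𝓘(ℝ, E) v.proj →L[ℝ] TangentSpace (𝓘(ℝ, E).tangent) v,
      (∀ v ∈ J1 π, K v v.2 = ξ v) →
      geodesicEquation π K = dynamicEquation π ξ ∧
      ∀ J : Set ℝ, IsOpen J → J.OrdConnected → ∀ c : ℝ → Q,
        (IsMotion π ξ J c ↔
          (∀ t ∈ J, π (c t) = t) ∧ IsSolution (geodesicEquation π K) J c) ∧
        (IsSolution (geodesicEquation π K) J c ↔
          ∃ a : ℝ, IsMotion π ξ ((fun s => s - a) ⁻¹' J) fun s => c (s - a)) := by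
  obtain ⟨X, hX⟩ := exists_isReferenceFrame hπ hsurj
  refine ⟨⟨associatedLift π X ξ, isDynamicConnection_associatedLift hπ hX hξ,
      isAssociatedConnection_associatedLift hπ hX hξ, generates_associatedLift hπ hX hξ⟩,
    fun γ hγ => ⟨frameExtension π X γ, isConnection_frameExtension hπ hX hγ,
      tddot_frameExtension hπ hX hγ, fun _ => frameExtension_of_mem_J1⟩,
    fun K hK => ?_⟩
  have hequation := geodesicEquation_eq_dynamicEquation hξ hK
  refine ⟨hequation, fun J hJ hJc c => ⟨by rw [hequation, IsMotion], ?_⟩⟩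
  have hJ1 : ∀ ζ ∈ geodesicEquation π K, ζ.proj ∈ J1 π := fun _ hζ => hζ.2.1
  rw [hequation] at hJ1 ⊢
  exact isSolution_iff_exists_shift hπ hJ1 hJ hJc

theorem theorem5p2
    {E : Type*} [NormedAddCommGroup E] [NormedSpace ℝ E] [FiniteDimensional ℝ E]
    {Q : Type*} [TopologicalSpace Q] [ChartedSpace E Q] [IsManifold 𝓘(ℝ, E) ∞ Q]
    [T2Space Q] [SecondCountableTopology Q]
    {F : Type*} [NormedAddCommGroup F] [NormedSpace ℝ F] [FiniteDimensional ℝ F]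
    {M : Type*} [TopologicalSpace M] [ChartedSpace F M] [IsManifold 𝓘(ℝ, F) ∞ M]
    (π : Q → ℝ) (hπ : TimeBundle.IsSmoothBundle (E := E) F M π)
    (ξ : ∀ v : TangentBundle 𝓘(ℝ, E) Q, TangentSpace (𝓘(ℝ, E).tangent) v)
    (hξ : TimeBundle.IsHolonomicConnection π ξ) :
    -- the dynamic connection `γ_ξ` exists and generates `ξ`
    (∃ γ : ∀ v : TangentBundle 𝓘(ℝ, E) Q,
        TangentSpace 𝓘(ℝ, E) v.proj →L[ℝ] TangentSpace (𝓘(ℝ, E).tangent) v,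
      TimeBundle.IsDynamicConnection π γ ∧ TimeBundle.IsAssociatedConnection π ξ γ ∧
        TimeBundle.Generates π γ ξ) ∧
    -- every dynamic connection `γ` generating `ξ` extends to a connection on `TQ → Q`
    ∀ γ : ∀ v : TangentBundle 𝓘(ℝ, E) Q,
        TangentSpace 𝓘(ℝ, E) v.proj →L[ℝ] TangentSpace (𝓘(ℝ, E).tangent) v,
      TimeBundle.IsDynamicConnection π γ → TimeBundle.Generates π γ ξ →
      (∃ K : ∀ v : TangentBundle 𝓘(ℝ, E) Q,
          TangentSpace 𝓘(ℝ, E) v.proj →L[ℝ] TangentSpace (𝓘(ℝ, E).tangent) v,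
        TimeBundle.IsConnection K ∧ (∀ v w, TimeBundle.tddot π v (K v w) = 0) ∧
          ∀ v ∈ TimeBundle.J1 π, K v = γ v) ∧
      -- and for every such extension the geodesic equation is equivalent to the dynamic equation
      ∀ K : ∀ v : TangentBundle 𝓘(ℝ, E) Q,
          TangentSpace 𝓘(ℝ, E) v.proj →L[ℝ] TangentSpace (𝓘(ℝ, E).tangent) v,
        TimeBundle.IsConnection K → (∀ v w, TimeBundle.tddot π v (K v w) = 0) →
        (∀ v ∈ TimeBundle.J1 π, K v = γ v) →
        TimeBundle.geodesicEquation π K = TimeBundle.dynamicEquation π ξ ∧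
        ∀ J : Set ℝ, IsOpen J → J.OrdConnected → ∀ c : ℝ → Q,
          (TimeBundle.IsMotion π ξ J c ↔
            (∀ t ∈ J, π (c t) = t) ∧
              TimeBundle.IsSolution (TimeBundle.geodesicEquation π K) J c) ∧
          (TimeBundle.IsSolution (TimeBundle.geodesicEquation π K) J c ↔
            ∃ a : ℝ, TimeBundle.IsMotion π ξ ((fun s => s - a) ⁻¹' J) fun s => c (s - a)) := by
  obtain ⟨hassociated, hextension, hequivalence⟩ :=
    theorem5p2_general π hπ.contMDiff hπ.surjective_mfderiv ξ hξ
  exact ⟨hassociated, fun γ hγ hγξ => ⟨hextension γ hγ, fun K _ _ hKγ =>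
    hequivalence K fun v hv => by rw [hKγ v hv, hγξ v hv]⟩⟩
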